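/- **Theorem 5.1.** Let $M$ be a smooth Riemannian manifold of dimension $n$ with metric $g$, let $\mathbb R^+=(0,\infty)$ and $\mathcal M=M\times\mathbb R^+$, with local coordinates $x^1,\dots,x^n$ on $M$ and $v$ on $\mathbb R^+$. All functions, forms and vector fields are $C^\infty$. A *force field* $\mathbf F$ on $M$ assigns to each $p\in M$ and each nonzero velocity $\mathbf v\in T_pM$ a vector $\mathbf F(p,\mathbf v)\in T_pM$. A pair $(h,W)$, where $W$ is a smooth function on an open set $O\subset\mathcal M$ with $W_v=\partial W/\partial v\ne0$ on $O$, and $h$ is a smooth function of one variable on $W(O)$, *represents* $\mathbf F$ in $O$ if for all $p$ and $\mathbf v\neq 0$ with $(p,|\mathbf v|)\in O$ $$F_k=\frac{h(W)\,N_k}{W_v}-v\sum_{i=1}^n\frac{\nabla_iW}{W_v}\bigl(2N^iN_k-\delta^i_k\bigr),\qquad v=|\mathbf v|,\quad \mathbf N=\frac{\mathbf v}{|\mathbf v|},\quad \nabla_iW=\frac{\partial W}{\partial x^i},\tag{1.4}$$ where $W$ and its derivatives are taken at $(p,|\mathbf v|)$ and indices are lowered by $g$. The force field $\mathbf F$ *is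 of the form (1.4)* if every point of $\mathcal M$ has an open neighborhood in which $\mathbf F$ is represented by some pair $(h,W)$. Let $\mathcal P^*\!\mathcal M$ be the bundle over $\mathcal M$ whose fiber at $q$ is the projective space of $T^*_q\mathcal M$. A smooth global section $\sigma$ of it is locally the class $[\omega]$ of a smooth nowhere vanishing $1$-form $\omega$, and $\operatorname{Ker}\sigma=\operatorname{Ker}\omega\subset T\mathcal M$ is a well-defined distribution. The section $\sigma$ is *closed* if $\operatorname{Ker}\sigma$ is involutive, that is, if the Lie bracket of any two (locally defined) smooth vector fields belonging to $\operatorname{Ker}\sigma$ belongs to $\operatorname{Ker}\sigma$. It is *transversal to the rulings* if at each $q=(p,v)$ the space $T_q\mathcal M$ is the direct sum of $\operatorname{Ker}\sigma_q$ and the tangent line of $\{p\}\times\mathbb R^+$. A section $\sigma$ *corresponds* to a force field $\mathbf F$ of the form (1.4) if $\sigma_q=[dW_q]$ for every pair $(h,W)$ that represents $\mathbf F$ in an open set $O$ and every $q\in O$. 1. For every force field $\mathbf F$ of the form (1.4) there is exactly one global section $\sigma$ of $\mathcal P^*\!\mathcal M$ that corresponds to $\mathbf F$. This section is smooth, closed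 and transversal to the rulings. 2. Conversely, every smooth closed global section of $\mathcal P^*\!\mathcal M$ that is transversal to the rulings corresponds to some force field of the form (1.4). -/

import Mathlib

open scoped Manifold ContDiff Bundle

namespace NormalShift

noncomputable section

/-- The half-line `ℝ⁺` of positive real numbers, as an open submanifold of `ℝ`. -/
abbrev PosReal : TopologicalSpace.Opens ℝ := ⟨Set.Ioi 0, isOpen_Ioi⟩

/-- The cylinder `M × ℝ⁺` over `M`. -/
abbrev Cyl (M : Type*) : Type _ := M × PosReal

/-- The model with corners of the cylinder `M × ℝ⁺` over an `n`-dimensional manifold `M`. -/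
abbrev cylModel (n : ℕ) :
    ModelWithCorners ℝ (EuclideanSpace ℝ (Fin n) × ℝ)
      (ModelProd (EuclideanSpace ℝ (Fin n)) ℝ) :=
  (𝓡 n).prod 𝓘(ℝ, ℝ)

variable {n : ℕ} {M : Type*} [TopologicalSpace M] [ChartedSpace (EuclideanSpace ℝ (Fin n)) M]

/-! ### Functions on the cylinder and their derivatives -/

/-- The differential `dW` of a function on `M × ℝ⁺` at the point `q`, a cotangent vector at `q`. -/
def differential (n : ℕ) {M : Type*} [TopologicalSpace M]
    [ChartedSpace (EuclideanSpace ℝ (Fin n)) M] (W : Cyl M → ℝ) (q : Cyl M) :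
    TangentSpace (cylModel n) q →L[ℝ] ℝ :=
  mfderiv (cylModel n) 𝓘(ℝ, ℝ) W q

/-- The partial gradient `∇W` at `q = (p, v)`: the differential at `p` of `x ↦ W (x, v)`; its
components in local coordinates of `M` are `∂W/∂xⁱ`. -/
def gradM (n : ℕ) {M : Type*} [TopologicalSpace M]
    [ChartedSpace (EuclideanSpace ℝ (Fin n)) M] (W : Cyl M → ℝ) (q : Cyl M) :
    TangentSpace (𝓡 n) q.1 →L[ℝ] ℝ :=
  mfderiv (𝓡 n) 𝓘(ℝ, ℝ) (fun x : M => W (x, q.2)) q.1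

/-- The partial derivative `W_v = ∂W/∂v` at `q = (p, v)`. The canonical chart of `ℝ⁺` is its
inclusion in `ℝ`, so the tangent vector `1` is `∂/∂v`. -/
def derivV {M : Type*} (W : Cyl M → ℝ) (q : Cyl M) : ℝ :=
  mfderiv 𝓘(ℝ, ℝ) 𝓘(ℝ, ℝ) (fun s : PosReal => W (q.1, s)) q.2 (1 : ℝ)

/-! ### Force fields -/

/-- A smooth Riemannian metric on the `n`-dimensional manifold `M`. -/
abbrev Metric (n : ℕ) (M : Type*) [TopologicalSpace M]
    [ChartedSpace (EuclideanSpace ℝ (Fin n)) M] [IsManifold (𝓡 n) ∞ M] : Type _ :=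
  Bundle.ContMDiffRiemannianMetric (𝓡 n) ∞ (EuclideanSpace ℝ (Fin n))
    (fun p : M => TangentSpace (𝓡 n) p)

/-- A force field: to each point `p` of `M` and each nonzero velocity vector at `p` it assigns
a tangent vector at `p`. -/
abbrev ForceField (n : ℕ) (M : Type*) [TopologicalSpace M]
    [ChartedSpace (EuclideanSpace ℝ (Fin n)) M] : Type _ :=
  ∀ p : M, {u : TangentSpace (𝓡 n) p // u ≠ 0} → TangentSpace (𝓡 n) p

/-- The modulus `|u|` of a nonzero tangent vector, a positive real number. -/
def speed [IsManifold (𝓡 n) ∞ M] (g : Metric n M) (p : M)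
    (u : {u : TangentSpace (𝓡 n) p // u ≠ 0}) : PosReal :=
  ⟨√(g.inner p u.1 u.1), Real.sqrt_pos.2 (g.pos p u.1 u.2)⟩

/-- The unit vector `N = u / |u|` in the direction of a nonzero tangent vector `u`. -/
def unitDir [IsManifold (𝓡 n) ∞ M] (g : Metric n M) (p : M)
    (u : {u : TangentSpace (𝓡 n) p // u ≠ 0}) : TangentSpace (𝓡 n) p :=
  (speed g p u : ℝ)⁻¹ • u.1

/-- The pair of functions `h = h(w)`, `W = W(x, v)`, the second one defined in the domain
`O ⊆ M × ℝ⁺`, represents the force field `F` in `O`: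
`F_k = h(W) N_k / W_v - v ∑ᵢ (∇ᵢW / W_v) (2 Nⁱ N_k - δⁱ_k)` with `W_v ≠ 0`, where `v = |u|` is the
modulus of the velocity vector `u`. The formula is contracted with an arbitrary vector `Xᵏ`:
`F_k Xᵏ = g(F, X)`, `N_k Xᵏ = g(N, X)`, `∑ᵢ ∇ᵢW Nⁱ = ∇W(N)`, `∑ᵢ ∇ᵢW δⁱ_k Xᵏ = ∇W(X)`. -/
structure Represents [IsManifold (𝓡 n) ∞ M] (g : Metric n M) (F : ForceField n M)
    (O : Set (Cyl M)) (h : ℝ → ℝ) (W : Cyl M → ℝ) : Prop where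
  isOpen : IsOpen O
  smooth_W : ContMDiffOn (cylModel n) 𝓘(ℝ, ℝ) ∞ W O
  smooth_h : ContDiffOn ℝ ∞ h (W '' O)
  derivV_ne_zero : ∀ q ∈ O, derivV W q ≠ 0
  formula : ∀ (p : M) (u : {u : TangentSpace (𝓡 n) p // u ≠ 0}), (p, speed g p u) ∈ O →
    ∀ X : TangentSpace (𝓡 n) p,
      g.inner p (F p u) X =
        h (W (p, speed g p u)) * g.inner p (unitDir g p u) X / derivV W (p, speed g p u)
          - (speed g p u : ℝ) *
            (2 * (gradM n W (p, speed g p u) (unitDir g p u) / derivV W (p, speed g p u))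
                * g.inner p (unitDir g p u) X
              - gradM n W (p, speed g p u) X / derivV W (p, speed g p u))

/-- The global force field `F` has the normal shift form: near each point of `M × ℝ⁺` it is
represented by some pair of functions `(h, W)`. -/
def HasNormalShiftForm [IsManifold (𝓡 n) ∞ M] (g : Metric n M) (F : ForceField n M) : Prop :=
  ∀ q : Cyl M, ∃ (O : Set (Cyl M)) (h : ℝ → ℝ) (W : Cyl M → ℝ),
    q ∈ O ∧ Represents g F O h W

/-! ### Sections of the projectivized cotangent bundle of the cylinder -/

/-- A (set-theoretic) global section of the projectivized cotangent bundle of `M × ℝ⁺`: a point of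
the projective space of the cotangent space at each point. -/
abbrev ProjSection (n : ℕ) (M : Type*) [TopologicalSpace M]
    [ChartedSpace (EuclideanSpace ℝ (Fin n)) M] : Type _ :=
  ∀ q : Cyl M, Projectivization ℝ (TangentSpace (cylModel n) q →L[ℝ] ℝ)

/-- The section is smooth: near each point it is represented by a smooth nowhere vanishing
differential 1-form. -/
def IsSmoothSection [IsManifold (𝓡 n) ∞ M] (σ : ProjSection n M) : Prop :=
  ∀ q₀ : Cyl M, ∃ (O : Set (Cyl M)) (θ : ∀ q : Cyl M, TangentSpace (cylModel n) q →L[ℝ] ℝ),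
    IsOpen O ∧ q₀ ∈ O ∧
    ContMDiffOn (cylModel n)
      ((cylModel n).prod 𝓘(ℝ, (EuclideanSpace ℝ (Fin n) × ℝ) →L[ℝ] ℝ)) ∞
      (fun q => (⟨q, θ q⟩ : Bundle.TotalSpace ((EuclideanSpace ℝ (Fin n) × ℝ) →L[ℝ] ℝ)
        (fun q : Cyl M => TangentSpace (cylModel n) q →L[ℝ] Bundle.Trivial (Cyl M) ℝ q))) O ∧
    ∀ q ∈ O, ∃ hθ : θ q ≠ 0, σ q = Projectivization.mk ℝ (θ q) hθ

/-- The distribution `U = Ker σ` on `M × ℝ⁺`: the kernel of any representative of `σ q`. -/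
def kerSection (σ : ProjSection n M) (q : Cyl M) : Submodule ℝ (TangentSpace (cylModel n) q) :=
  LinearMap.ker ((σ q).rep : TangentSpace (cylModel n) q →ₗ[ℝ] ℝ)

/-- A field of tangent subspaces on the cylinder is involutive: the Lie bracket of two (locally
defined) smooth vector fields that belong to it belongs to it. -/
def IsInvolutive [IsManifold (𝓡 n) ∞ M]
    (U : ∀ q : Cyl M, Submodule ℝ (TangentSpace (cylModel n) q)) : Prop :=
  ∀ (O : Set (Cyl M)) (X Y : ∀ q : Cyl M, TangentSpace (cylModel n) q), IsOpen O →
    ContMDiffOn (cylModel n) (cylModel n).tangent ∞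
      (fun q => (⟨q, X q⟩ : TangentBundle (cylModel n) (Cyl M))) O →
    ContMDiffOn (cylModel n) (cylModel n).tangent ∞
      (fun q => (⟨q, Y q⟩ : TangentBundle (cylModel n) (Cyl M))) O →
    (∀ q ∈ O, X q ∈ U q) → (∀ q ∈ O, Y q ∈ U q) →
    ∀ q ∈ O, VectorField.mlieBracket (cylModel n) X Y q ∈ U q

/-- A section of the projectivized cotangent bundle is closed if its kernel distribution is
involutive. -/
def IsClosedSection [IsManifold (𝓡 n) ∞ M] (σ : ProjSection n M) : Prop :=
  IsInvolutive (kerSection σ)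

/-- The tangent line at `q = (p, v)` of the linear ruling `{p} × ℝ⁺` of the cylinder. -/
def rulingTangent (n : ℕ) {M : Type*} [TopologicalSpace M]
    [ChartedSpace (EuclideanSpace ℝ (Fin n)) M] (q : Cyl M) :
    Submodule ℝ (TangentSpace (cylModel n) q) :=
  LinearMap.range (mfderiv 𝓘(ℝ, ℝ) (cylModel n) (fun s : PosReal => ((q.1, s) : Cyl M)) q.2 :
    TangentSpace 𝓘(ℝ, ℝ) q.2 →ₗ[ℝ] TangentSpace (cylModel n) q)

/-- The kernel distribution of the section is transversal to the linear rulings of `M × ℝ⁺`. -/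
def IsTransversal (σ : ProjSection n M) : Prop :=
  ∀ q : Cyl M, IsCompl (kerSection σ q) (rulingTangent n q)

/-- `σ` is the section determined by `F`: for every pair `(h, W)` that represents `F` in a domain
`O`, the value of `σ` at each point of `O` is the class of `dW`. -/
def Determines [IsManifold (𝓡 n) ∞ M] (g : Metric n M) (F : ForceField n M)
    (σ : ProjSection n M) : Prop :=
  ∀ (O : Set (Cyl M)) (h : ℝ → ℝ) (W : Cyl M → ℝ), Represents g F O h W →
    ∀ q ∈ O, ∃ hW : differential n W q ≠ 0,
      σ q = Projectivization.mk ℝ (differential n W q) hW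

end

end NormalShift

/-!
The force (1.4) has the form `a N - v (2 b(N) N - b)` with `b = ∇W / W_v`. Pairing it with the
velocity, once in the direction `u` and once in the direction `-u`, recovers `b`; and `b` determines
`dW` up to a factor, because `W_v ≠ 0`. So the class of `dW` depends on the force alone. The kernel
of `dW` is involutive since `dW [X, Y] = X (dW Y) - Y (dW X)`.

Conversely, let `θ` be a nowhere vanishing 1-form with involutive kernel. In a chart let `Q y` be
the projection onto `ker θ_y` along a fixed vector. The fields `y ↦ Q y ξ` commute, so the time-one
map `Φ (ξ, q)` of the flow of the field with parameter `ξ`, started at `q`, satisfies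
`dΦ (η, Q q α) = Q (Φ (ξ, q)) (α + η)`; it is smooth in `(ξ, q)` by the implicit function theorem
applied to the Picard operator on `C([0, 1], V)`. Hence `ρ y = Φ (y₀ - y, y)` is constant along
`ker θ`, and `W = θ_{y₀} ∘ ρ` is a first integral: `dW = c θ` with `c ≠ 0`. Transversality to the
rulings says exactly that `W_v ≠ 0`, and the pair `(0, W)` then represents the required force.
-/

namespace NormalShift

open Set Filter Topology VectorField

section Postcomposition

variable {K : Type*} [TopologicalSpace K] [CompactSpace K]
  {E F : Type*} [NormedAddCommGroup E] [NormedSpace ℝ E] [NormedAddCommGroup F] [NormedSpace ℝ F]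
  {G : Type*} [NormedAddCommGroup G] [NormedSpace ℝ G]

/-- Pointwise application of a continuous bilinear map to continuous functions. -/
noncomputable def pointwise (B : E →L[ℝ] F →L[ℝ] G) : C(K, E) →L[ℝ] C(K, F) →L[ℝ] C(K, G) :=
  LinearMap.mkContinuous₂
    (LinearMap.mk₂ ℝ
      (fun u w => (⟨fun s => B (u s) (w s), by fun_prop⟩ : C(K, G)))
      (fun _ _ _ => by ext; simp) (fun _ _ _ => by ext; simp)
      (fun _ _ _ => by ext; simp) (fun _ _ _ => by ext; simp)) ‖B‖
    fun u w => (ContinuousMap.norm_le _ (by positivity)).2 fun s =>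
      (B.le_opNorm₂ (u s) (w s)).trans
        (by gcongr; exacts [u.norm_coe_le_norm s, w.norm_coe_le_norm s])

/-- Pointwise application of a continuous family of operators. -/
noncomputable abbrev pointwiseApply (A : C(K, E →L[ℝ] F)) : C(K, E) →L[ℝ] C(K, F) :=
  pointwise (.id ℝ (E →L[ℝ] F)) A

@[simp] lemma pointwiseApply_apply (A : C(K, E →L[ℝ] F)) (w : C(K, E)) (s : K) :
    pointwiseApply A w s = A s (w s) := rfl

theorem exists_forall_mem_ball_dist_lt {X Y : Type*} [PseudoMetricSpace X] [PseudoMetricSpace Y]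
    {f : X → Y} (hf : Continuous f) (u : C(K, X)) {ε : ℝ} (hε : 0 < ε) :
    ∃ δ > 0, ∀ s, ∀ x ∈ Metric.ball (u s) δ, dist (f x) (f (u s)) < ε := by
  obtain ⟨δ, hδ, hdist⟩ := Metric.mem_uniformity_dist.1
    ((isCompact_range u.continuous).uniformContinuousAt_of_continuousAt f
      (fun x _ => hf.continuousAt) (Metric.dist_mem_uniformity hε))
  refine ⟨δ, hδ, fun s x hx => ?_⟩
  rw [dist_comm]
  exact hdist (Metric.mem_ball'.1 hx) (mem_range_self s)

theorem hasFDerivAt_postcomp (f : C(E, F)) (f' : C(E, E →L[ℝ] F))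
    (hf : ∀ x, HasFDerivAt f (f' x) x) (u : C(K, E)) :
    HasFDerivAt (fun u : C(K, E) => f.comp u) (pointwiseApply (f'.comp u)) u := by
  refine HasFDerivAt.of_isLittleO (Asymptotics.isLittleO_iff.2 fun ε hε => ?_)
  obtain ⟨δ, hδ, hdist⟩ := exists_forall_mem_ball_dist_lt f'.continuous u hε
  filter_upwards [Metric.ball_mem_nhds u hδ] with w hw
  refine (ContinuousMap.norm_le _ (by positivity)).2 fun s => ?_
  have hws : w s ∈ Metric.ball (u s) δ := (ContinuousMap.dist_apply_le_dist s).trans_lt hw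
  calc ‖(f.comp w - f.comp u - pointwiseApply (f'.comp u) (w - u)) s‖ ≤ ε * ‖w s - u s‖ :=
        (convex_ball (u s) δ).norm_image_sub_le_of_norm_hasFDerivWithin_le'
          (fun x _ => (hf x).hasFDerivWithinAt)
          (fun x hx => (dist_eq_norm _ _).symm.trans_le (hdist s x hx).le)
          (Metric.mem_ball_self hδ) hws
    _ ≤ ε * ‖w - u‖ := by gcongr; exact (w - u).norm_coe_le_norm s

universe u

theorem contDiff_postcomp_nat {E : Type u} [NormedAddCommGroup E] [NormedSpace ℝ E] (m : ℕ) :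
    ∀ {F : Type u} [NormedAddCommGroup F] [NormedSpace ℝ F] (f : C(E, F)),
      ContDiff ℝ m f → ContDiff ℝ m fun u : C(K, E) => f.comp u := by
  induction m with
  | zero => exact fun f _ => contDiff_zero.2 (ContinuousMap.continuous_postcomp f)
  | succ m ih =>
    intro F _ _ f hf
    push_cast at hf ⊢
    obtain ⟨hdiff, -, hf'⟩ := contDiff_succ_iff_fderiv.1 hf
    exact contDiff_succ_iff_hasFDerivAt.2
      ⟨_, (pointwise (.id ℝ (E →L[ℝ] F))).contDiff.comp (ih ⟨fderiv ℝ f, hf'.continuous⟩ hf'),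
        hasFDerivAt_postcomp f _ fun x => (hdiff x).hasFDerivAt⟩

theorem contDiff_postcomp {E F : Type u} [NormedAddCommGroup E] [NormedSpace ℝ E]
    [NormedAddCommGroup F] [NormedSpace ℝ F] (f : C(E, F)) (hf : ContDiff ℝ ∞ f) :
    ContDiff ℝ ∞ fun u : C(K, E) => f.comp u :=
  contDiff_infty.2 fun m => contDiff_postcomp_nat m f (hf.of_le (by exact_mod_cast le_top))

end Postcomposition

theorem exists_contDiffAt_implicitFunction {E₁ E₂ F : Type*}
    [NormedAddCommGroup E₁] [NormedSpace ℝ E₁] [CompleteSpace E₁]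
    [NormedAddCommGroup E₂] [NormedSpace ℝ E₂] [CompleteSpace E₂]
    [NormedAddCommGroup F] [NormedSpace ℝ F] [CompleteSpace F]
    {f : E₁ × E₂ → F} {u : E₁ × E₂} {n : ℕ∞ω} (hn : n ≠ 0) (hf : ∀ᶠ v in 𝓝 u, ContDiffAt ℝ n f v)
    (hinv : (fderiv ℝ f u ∘L .inr ℝ E₁ E₂).IsInvertible) :
    ∃ ψ : E₁ → E₂, ψ u.1 = u.2 ∧
      ∀ᶠ x in 𝓝 u.1, ContDiffAt ℝ n ψ x ∧ f (x, ψ x) = f u := by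
  have hfu : ContDiffAt ℝ n f u := hf.self_of_nhds
  set ψ := hfu.implicitFunction hn hinv
  have hψu : ψ u.1 = u.2 := hfu.implicitFunction_apply_self hn hinv
  have hψ : ∀ᶠ x in 𝓝 u.1, ContinuousAt ψ x ∧ f (x, ψ x) = f u := by
    have hone : ContDiffAt ℝ 1 ψ u.1 :=
      (hfu.contDiffAt_implicitFunction hn hinv).of_le (ENat.one_le_iff_ne_zero_withTop.2 hn)
    exact ((hone.eventually (by simp)).mono fun x hx => hx.continuousAt).and
      (hfu.eventually_apply_implicitFunction hn hinv)
  have hinv_near : ∀ᶠ v in 𝓝 u, (fderiv ℝ f v ∘L .inr ℝ E₁ E₂).IsInvertible := by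
    obtain ⟨e, he⟩ := hinv
    have hcont : ContinuousAt (fun v => fderiv ℝ f v ∘L .inr ℝ E₁ E₂) u :=
      (hfu.fderiv_right (m := 0) (by simpa using ENat.one_le_iff_ne_zero_withTop.2 hn)).continuousAt
        |>.clm_comp continuousAt_const
    exact hcont.eventually (show ∀ᶠ T in 𝓝 (fderiv ℝ f u ∘L .inr ℝ E₁ E₂), T.IsInvertible from
      he ▸ e.nhds)
  have htendsto : Tendsto (fun x => (x, ψ x)) (𝓝 u.1) (𝓝 u) := by
    have := continuousAt_id.prodMk hψ.self_of_nhds.1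
    rwa [ContinuousAt, id, hψu] at this
  refine ⟨ψ, hψu, ?_⟩
  filter_upwards [htendsto.eventually (hf.and hinv_near), hψ.eventually_nhds]
    with x ⟨hfx, hinvx⟩ hψx
  refine ⟨(hfx.contDiffAt_implicitFunction hn hinvx).congr_of_eventuallyEq ?_, hψx.self_of_nhds.2⟩
  have hgraph : Tendsto (fun x' => (x', ψ x')) (𝓝 x) (𝓝 (x, ψ x)) :=
    continuousAt_id.prodMk hψx.self_of_nhds.1
  filter_upwards [hgraph.eventually (hfx.eventually_apply_eq_iff_implicitFunction hn hinvx), hψx]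
    with x' hiff hx'
  exact (hiff.1 (hx'.2.trans hψx.self_of_nhds.2.symm)).symm

section Flow

open unitInterval

universe u

variable {V : Type u} [NormedAddCommGroup V] [NormedSpace ℝ V]

/-- The operator `w ↦ ∫₀ˢ w` on continuous functions on the unit interval. -/
noncomputable def primitive : C(I, V) →L[ℝ] C(I, V) :=
  LinearMap.mkContinuous
    { toFun := fun w => ⟨fun s => ∫ r in (0 : ℝ)..s, IccExtend zero_le_one w r,
        (intervalIntegral.continuous_primitive
          (fun _ _ => (w.continuous.Icc_extend' (h := zero_le_one)).intervalIntegrable _ _)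
          0).comp continuous_subtype_val⟩
      map_add' := fun w₁ w₂ => ContinuousMap.ext fun _ => intervalIntegral.integral_add
        ((w₁.continuous.Icc_extend' (h := zero_le_one)).intervalIntegrable _ _)
        ((w₂.continuous.Icc_extend' (h := zero_le_one)).intervalIntegrable _ _)
      map_smul' := fun c _ => ContinuousMap.ext fun _ => intervalIntegral.integral_smul c _ } 1
    fun w => (ContinuousMap.norm_le _ (by positivity)).2 fun s => by
      have hle := intervalIntegral.norm_integral_le_of_norm_le_const (a := (0 : ℝ)) (b := s)
        (f := IccExtend zero_le_one w) (C := ‖w‖) fun _ _ => w.norm_coe_le_norm _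
      rw [sub_zero, abs_of_nonneg s.2.1] at hle
      exact hle.trans ((mul_le_of_le_one_right (norm_nonneg _) s.2.2).trans (one_mul ‖w‖).ge)

lemma primitive_apply_zero (w : C(I, V)) : primitive w 0 = 0 :=
  intervalIntegral.integral_same

theorem eq_zero_of_hasDerivWithinAt_clm {A : ℝ → V →L[ℝ] V} {f : ℝ → V}
    (hA : ContinuousOn A (Icc 0 1)) (hf : ContinuousOn f (Icc 0 1))
    (hderiv : ∀ s ∈ Ico (0 : ℝ) 1, HasDerivWithinAt f (A s (f s)) (Ici s) s) (hf₀ : f 0 = 0) :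
    ∀ s ∈ Icc (0 : ℝ) 1, f s = 0 := by
  obtain ⟨C, hC⟩ := isCompact_Icc.exists_bound_of_continuousOn hA
  exact eq_zero_of_abs_deriv_le_mul_abs_self_of_eq_zero_right hf hderiv hf₀ fun s hs =>
    (A s).le_of_opNorm_le (hC s ⟨hs.1, hs.2.le⟩) (f s)

variable {E : Type u} [NormedAddCommGroup E] [NormedSpace ℝ E]

/-- The Picard operator of the initial value problem `u' = X(u) ξ`, `u(0) = q` with parameter `ξ`;
its arguments are arranged as `((ξ, q), u)`. -/
noncomputable def picard (X : C(V, E →L[ℝ] V)) (p : (E × V) × C(I, V)) : C(I, V) :=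
  ContinuousMap.const I p.1.2 + primitive (pointwiseApply (X.comp p.2) (.const I p.1.1))

theorem contDiff_picard {X : C(V, E →L[ℝ] V)} (hX : ContDiff ℝ ∞ X) : ContDiff ℝ ∞ (picard X) := by
  have hfield : ContDiff ℝ ∞ fun p : (E × V) × C(I, V) => X.comp p.2 :=
    (contDiff_postcomp X hX).comp contDiff_snd
  have hparam : ContDiff ℝ ∞ fun p : (E × V) × C(I, V) => ContinuousMap.const I p.1.1 :=
    (ContinuousLinearMap.const ℝ I (M := E)).contDiff.comp (contDiff_fst.comp contDiff_fst)
  exact ((ContinuousLinearMap.const ℝ I (M := V)).contDiff.comp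
      (contDiff_snd.comp contDiff_fst)).add
    ((primitive (V := V)).contDiff.comp
      ((pointwise (K := I) (.id ℝ (E →L[ℝ] V))).isBoundedBilinearMap.contDiff.comp
        (hfield.prodMk hparam)))

theorem exists_hasFDerivAt_picard {X : C(V, E →L[ℝ] V)} {X' : C(V, V →L[ℝ] E →L[ℝ] V)}
    (hX : ∀ q, HasFDerivAt X (X' q) q) (p : (E × V) × C(I, V)) :
    ∃ D : (E × V) × C(I, V) →L[ℝ] C(I, V), HasFDerivAt (picard X) D p ∧
      ∀ h, D h = ContinuousMap.const I h.1.2 +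
        primitive (pointwiseApply (X.comp p.2) (.const I h.1.1) +
          pointwiseApply (pointwiseApply (X'.comp p.2) h.2) (.const I p.1.1)) := by
  let L : (E × V) × C(I, V) →L[ℝ] C(I, E) :=
    .const ℝ I ∘L .fst ℝ E V ∘L .fst ℝ (E × V) C(I, V)
  let M : (E × V) × C(I, V) →L[ℝ] C(I, V) :=
    .const ℝ I ∘L .snd ℝ E V ∘L .fst ℝ (E × V) C(I, V)
  have hfield : HasFDerivAt (fun p : (E × V) × C(I, V) => X.comp p.2)
      (pointwiseApply (X'.comp p.2) ∘L ContinuousLinearMap.snd ℝ (E × V) C(I, V)) p :=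
    (hasFDerivAt_postcomp X X' hX p.2).comp p hasFDerivAt_snd
  have hvel := (pointwise (K := I) (.id ℝ (E →L[ℝ] V))).hasFDerivAt_of_bilinear
    (G' := (E × V) × C(I, V)) hfield L.hasFDerivAt
  exact ⟨_, M.hasFDerivAt.add ((primitive (V := V)).hasFDerivAt.comp p hvel), fun _ => rfl⟩

theorem fderiv_eq_of_eventuallyEq_picard {X : C(V, E →L[ℝ] V)} {X' : C(V, V →L[ℝ] E →L[ℝ] V)}
    (hX : ∀ q, HasFDerivAt X (X' q) q) {u : E × V → C(I, V)} {z : E × V}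
    (hu : DifferentiableAt ℝ u z) (hfix : u =ᶠ[𝓝 z] fun z => picard X (z, u z)) (h : E × V) :
    fderiv ℝ u z h = ContinuousMap.const I h.2 +
      primitive (pointwiseApply (X.comp (u z)) (.const I h.1) +
        pointwiseApply (pointwiseApply (X'.comp (u z)) (fderiv ℝ u z h)) (.const I z.1)) := by
  have hgraph : HasFDerivAt (fun z => (z, u z))
      ((ContinuousLinearMap.id ℝ (E × V)).prod (fderiv ℝ u z)) z :=
    (hasFDerivAt_id z).prodMk hu.hasFDerivAt
  obtain ⟨D, hD, hDapply⟩ := exists_hasFDerivAt_picard hX (z, u z)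
  conv_lhs => rw [((hD.comp z hgraph).congr_of_eventuallyEq hfix).fderiv]
  exact hDapply _

variable [CompleteSpace V]

theorem hasDerivWithinAt_of_eq_const_add_primitive {u w : C(I, V)} {c : V}
    (hu : u = ContinuousMap.const I c + primitive w) {s : ℝ} (hs : s ∈ Ico (0 : ℝ) 1) :
    HasDerivWithinAt (IccExtend zero_le_one u) (w ⟨s, hs.1, hs.2.le⟩) (Ici s) s := by
  have hw : Continuous (IccExtend (zero_le_one (α := ℝ)) w) := w.continuous.Icc_extend'
  have hext : EqOn (IccExtend zero_le_one u) (fun r => c + ∫ t in (0 : ℝ)..r,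
      IccExtend zero_le_one w t) (Icc 0 1) := fun r hr => by
    rw [IccExtend_of_mem _ _ hr, hu]
    rfl
  have hderiv := ((hw.integral_hasStrictDerivAt 0 s).hasDerivAt.const_add c).hasDerivWithinAt
    (s := Ici s)
  rw [IccExtend_of_mem _ _ ⟨hs.1, hs.2.le⟩] at hderiv
  refine hderiv.congr_of_eventuallyEq ?_ (hext ⟨hs.1, hs.2.le⟩)
  filter_upwards [Ico_mem_nhdsGE hs.2] with r hr
  exact hext ⟨hs.1.trans hr.1, hr.2.le⟩

theorem exists_contDiffAt_eq_picard [CompleteSpace E] {X : C(V, E →L[ℝ] V)}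
    (hX : ContDiff ℝ ∞ X) (q₀ : V) :
    ∃ u : E × V → C(I, V), u (0, q₀) = ContinuousMap.const I q₀ ∧
      ∀ᶠ z in 𝓝 (0, q₀), ContDiffAt ℝ ∞ u z ∧ u z = picard X (z, u z) := by
  let X' : C(V, V →L[ℝ] E →L[ℝ] V) := ⟨fderiv ℝ X, hX.continuous_fderiv (by simp)⟩
  have hX' (q : V) : HasFDerivAt X (X' q) q := (hX.differentiable (by simp) q).hasFDerivAt
  let p₀ : (E × V) × C(I, V) := ((0, q₀), ContinuousMap.const I q₀)
  have hsmooth : ContDiff ℝ ∞ fun p : (E × V) × C(I, V) => p.2 - picard X p :=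
    contDiff_snd.sub (contDiff_picard hX)
  obtain ⟨D, hD, hDapply⟩ := exists_hasFDerivAt_picard hX' p₀
  have hderiv : fderiv ℝ (fun p : (E × V) × C(I, V) => p.2 - picard X p) p₀ ∘L
      .inr ℝ (E × V) C(I, V) = .id ℝ C(I, V) := by
    ext1 w
    rw [ContinuousLinearMap.comp_apply, (hasFDerivAt_snd.fun_sub hD).fderiv, sub_apply, hDapply]
    simp [p₀]
  obtain ⟨u, hu₀, hu⟩ := exists_contDiffAt_implicitFunction (by simp : (∞ : ℕ∞ω) ≠ 0)
    (Eventually.of_forall fun p => hsmooth.contDiffAt (x := p)) (u := p₀)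
    (hderiv ▸ ⟨.refl ℝ C(I, V), rfl⟩)
  have hp₀ : p₀.2 - picard X p₀ = 0 := by simp [p₀, picard]
  exact ⟨u, hu₀, hu.mono fun z hz => ⟨hz.1, sub_eq_zero.1 (hz.2.trans hp₀)⟩⟩

theorem variation_eq_of_commute {X : C(V, E →L[ℝ] V)} {X' : C(V, V →L[ℝ] E →L[ℝ] V)}
    (hX : ∀ q, HasFDerivAt X (X' q) q) {u z : C(I, V)} {ξ η α : E} {q : V}
    (hu : u = picard X ((ξ, q), u))
    (hz : z = ContinuousMap.const I (X q α) + primitive (pointwiseApply (X.comp u) (.const I η) +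
      pointwiseApply (pointwiseApply (X'.comp u) z) (.const I ξ)))
    (hcomm : ∀ s β γ, X' (u s) (X (u s) β) γ = X' (u s) (X (u s) γ) β) (s : I) :
    z s = X (u s) (α + (s : ℝ) • η) := by
  let ū : ℝ → V := IccExtend zero_le_one u
  let z' : ℝ → V := IccExtend zero_le_one z
  have hū : Continuous ū := u.continuous.Icc_extend'
  have hz' : Continuous z' := z.continuous.Icc_extend'
  let f : ℝ → V := fun t => z' t - X (ū t) (α + t • η)
  have hf : Continuous f :=
    hz'.sub ((X.continuous.comp hū).clm_apply (by fun_prop))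
  have hA : Continuous fun t => (X' (ū t)).flip ξ :=
    ((ContinuousLinearMap.flipₗᵢ ℝ V E V).continuous.comp (X'.continuous.comp hū)).clm_apply
      continuous_const
  have hderiv : ∀ t ∈ Ico (0 : ℝ) 1, HasDerivWithinAt f ((X' (ū t)).flip ξ (f t)) (Ici t) t := by
    intro t ht
    obtain ⟨τ, rfl⟩ : ∃ τ : I, τ = t := ⟨⟨t, ht.1, ht.2.le⟩, rfl⟩
    have hūτ : ū τ = u τ := IccExtend_val _ _ τ
    have hz'τ : z' τ = z τ := IccExtend_val _ _ τ
    have hline : HasDerivWithinAt (fun t : ℝ => α + t • η) η (Ici τ) τ := by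
      simpa using (((hasDerivAt_id (τ : ℝ)).smul_const η).const_add α).hasDerivWithinAt
    have hūX : HasDerivWithinAt (fun t => X (ū t)) (X' (ū τ) (X (ū τ) ξ)) (Ici τ) τ :=
      (hX (ū τ)).comp_hasDerivWithinAt _
        (hūτ ▸ hasDerivWithinAt_of_eq_const_add_primitive hu ht)
    refine ((hasDerivWithinAt_of_eq_const_add_primitive hz ht).sub
      (hūX.clm_apply hline)).congr_deriv ?_
    simp only [f, hūτ, hz'τ, hcomm τ ξ, ContinuousMap.add_apply, pointwiseApply_apply,
      ContinuousMap.comp_apply, ContinuousMap.const_apply, ContinuousLinearMap.flip_apply, map_sub]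
    abel
  have hf₀ : f 0 = 0 := by
    have hu₀ : u 0 = q := by rw [hu]; simp [picard, primitive_apply_zero]
    have hz₀ : z 0 = X q α := by rw [hz]; simp [primitive_apply_zero]
    have hū0 : ū 0 = u 0 := IccExtend_of_mem _ _ ⟨le_rfl, zero_le_one⟩
    have hz0 : z' 0 = z 0 := IccExtend_of_mem _ _ ⟨le_rfl, zero_le_one⟩
    simp [f, hū0, hz0, hu₀, hz₀]
  have hfs := eq_zero_of_hasDerivWithinAt_clm hA.continuousOn hf.continuousOn hderiv hf₀ s s.2
  simpa [f, ū, z', sub_eq_zero] using hfs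

theorem exists_flow_of_commute [CompleteSpace E] {X : V → E →L[ℝ] V} (hX : ContDiff ℝ ∞ X) {q₀ : V}
    (hcomm : ∀ᶠ q in 𝓝 q₀, ∀ β γ, fderiv ℝ X q (X q β) γ = fderiv ℝ X q (X q γ) β) :
    ∃ Φ : E × V → V, (∀ᶠ q in 𝓝 q₀, Φ (0, q) = q) ∧ ∀ᶠ z in 𝓝 (0, q₀),
      ContDiffAt ℝ ∞ Φ z ∧ ∀ η α, fderiv ℝ Φ z (η, X z.2 α) = X (Φ z) (α + η) := by
  let Xc : C(V, E →L[ℝ] V) := ⟨X, hX.continuous⟩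
  let X' : C(V, V →L[ℝ] E →L[ℝ] V) := ⟨fderiv ℝ X, hX.continuous_fderiv (by simp)⟩
  have hX' (q : V) : HasFDerivAt Xc (X' q) q := (hX.differentiable (by simp) q).hasFDerivAt
  obtain ⟨u, hu₀, hu⟩ := exists_contDiffAt_eq_picard (X := Xc) hX q₀
  let eval : C(I, V) →L[ℝ] V := ContinuousMap.evalCLM ℝ 1
  refine ⟨fun z => eval (u z), ?_, ?_⟩
  · have htendsto : Tendsto (fun q : V => ((0 : E), q)) (𝓝 q₀) (𝓝 (0, q₀)) :=
      (Continuous.prodMk_right 0).tendsto q₀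
    filter_upwards [htendsto.eventually hu] with q hq
    rw [hq.2]
    simp [eval, picard]
  have hstay : ∀ᶠ z in 𝓝 (0, q₀), ∀ s,
      ∀ β γ, X' (u z s) (X (u z s) β) γ = X' (u z s) (X (u z s) γ) β := by
    obtain ⟨U, hU, hUo, hq₀U⟩ := eventually_nhds_iff.1 hcomm
    have hmaps : MapsTo (u (0, q₀)) univ U := by simp [hu₀, MapsTo, hq₀U]
    filter_upwards [hu.self_of_nhds.1.continuousAt.eventually
      (ContinuousMap.eventually_mapsTo isCompact_univ hUo hmaps)] with z hz s
    exact hU _ (hz (mem_univ s))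
  filter_upwards [hu.eventually_nhds, hstay] with z hz hzcomm
  obtain ⟨hzdiff, hzfix⟩ := hz.self_of_nhds
  refine ⟨eval.contDiff.contDiffAt.comp z hzdiff, fun η α => ?_⟩
  have hdiff : DifferentiableAt ℝ u z := hzdiff.differentiableAt (by simp)
  have hΦ : HasFDerivAt (fun z => eval (u z)) _ z := eval.hasFDerivAt.comp z hdiff.hasFDerivAt
  rw [hΦ.fderiv]
  simpa [eval, Xc] using variation_eq_of_commute hX' hzfix
    (fderiv_eq_of_eventuallyEq_picard hX' hdiff (hz.mono fun _ h => h.2) (η, X z.2 α)) hzcomm 1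

end Flow

section Frobenius

variable {V : Type*} [NormedAddCommGroup V] [NormedSpace ℝ V]

theorem exists_retraction_of_commute [CompleteSpace V] {Q : V → V →L[ℝ] V} (hQ : ContDiff ℝ ∞ Q)
    {y₀ : V} (hproj : ∀ᶠ p in 𝓝 (y₀, y₀), Q p.1 ∘L Q p.2 = Q p.1)
    (hcomm : ∀ᶠ y in 𝓝 y₀, ∀ ξ η, fderiv ℝ Q y (Q y ξ) η = fderiv ℝ Q y (Q y η) ξ) :
    ∃ ρ : V → V, (∀ᶠ y in 𝓝 y₀, ContDiffAt ℝ ∞ ρ y ∧ fderiv ℝ ρ y ∘L Q y = 0) ∧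
      fderiv ℝ ρ y₀ = .id ℝ V - Q y₀ := by
  obtain ⟨Φ, hΦ₀, hΦ⟩ := exists_flow_of_commute hQ hcomm
  let γ : V → V × V := fun y => (y₀ - y, y)
  have hγ : ContDiff ℝ ∞ γ := (contDiff_const.sub contDiff_id).prodMk contDiff_id
  have hγ' (y : V) : HasFDerivAt γ ((-ContinuousLinearMap.id ℝ V).prod (.id ℝ V)) y :=
    ((hasFDerivAt_id y).const_sub y₀).prodMk (hasFDerivAt_id y)
  have hγ₀ : Tendsto γ (𝓝 y₀) (𝓝 (0, y₀)) := by
    simpa [γ] using hγ.continuous.tendsto y₀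
  have hfderiv {y : V} (h : ContDiffAt ℝ ∞ Φ (γ y)) (w : V) :
      fderiv ℝ (Φ ∘ γ) y w = fderiv ℝ Φ (γ y) (-w, w) := by
    rw [((h.differentiableAt (by simp)).hasFDerivAt.comp y (hγ' y)).fderiv]
    rfl
  refine ⟨Φ ∘ γ, ?_, ?_⟩
  · have hpair : Tendsto (fun y => (Φ (γ y), y)) (𝓝 y₀) (𝓝 (y₀, y₀)) := by
      have hΦγ := hΦ.self_of_nhds.1.continuousAt.tendsto.comp hγ₀
      rw [hΦ₀.self_of_nhds] at hΦγ
      exact hΦγ.prodMk_nhds tendsto_id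
    filter_upwards [hγ₀.eventually hΦ, hpair.eventually hproj] with y ⟨hsmooth, hderiv⟩ hQΦ
    refine ⟨hsmooth.comp y hγ.contDiffAt, ContinuousLinearMap.ext fun α => ?_⟩
    have hQQ : Q (Φ (γ y)) (Q y α) = Q (Φ (γ y)) α := congr($hQΦ α)
    have hα := hderiv (-Q y α) α
    rw [map_add, map_neg, hQQ, add_neg_cancel] at hα
    exact (hfderiv hsmooth _).trans hα
  · have hγy₀ : γ y₀ = (0, y₀) := by simp [γ]
    obtain ⟨hsmooth₀, hderiv₀⟩ := hΦ.self_of_nhds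
    have hsmooth : ContDiffAt ℝ ∞ Φ (γ y₀) := hγy₀ ▸ hsmooth₀
    have hΦy : HasFDerivAt (fun y => Φ (0, y)) (fderiv ℝ Φ (0, y₀) ∘L .inr ℝ V V) y₀ :=
      (hsmooth₀.differentiableAt (by simp)).hasFDerivAt.comp y₀ (hasFDerivAt_prodMk_right 0 y₀)
    have hinr : fderiv ℝ Φ (0, y₀) ∘L .inr ℝ V V = .id ℝ V :=
      hΦy.unique ((hasFDerivAt_id y₀).congr_of_eventuallyEq hΦ₀)
    ext w
    have hsplit : ((-w, w) : V × V) = (-w, Q y₀ 0) + (0, w) := by simp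
    have hw : fderiv ℝ Φ (0, y₀) (0, w) = w := congr($hinr w)
    rw [hfderiv hsmooth, hγy₀, hsplit, map_add, hderiv₀, hw, hΦ₀.self_of_nhds]
    simp [neg_add_eq_sub]

theorem exists_contDiff_eventuallyEq [HasContDiffBump V] {F : Type*} [NormedAddCommGroup F]
    [NormedSpace ℝ F] {f : V → F} {x₀ : V} (hf : ∀ᶠ x in 𝓝 x₀, ContDiffAt ℝ ∞ f x) :
    ∃ g : V → F, ContDiff ℝ ∞ g ∧ g =ᶠ[𝓝 x₀] f := by
  obtain ⟨δ, hδ, hball⟩ := Metric.eventually_nhds_iff_ball.1 hf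
  let χ : ContDiffBump x₀ := ⟨δ / 3, δ / 2, by positivity, by linarith⟩
  refine ⟨fun x => χ x • f x, contDiff_iff_contDiffAt.2 fun x => ?_, ?_⟩
  · by_cases hx : x ∈ Metric.ball x₀ δ
    · exact χ.contDiff.contDiffAt.smul (hball x hx)
    · have hxχ : x ∉ tsupport χ := by
        rw [χ.tsupport_eq]
        exact fun h => hx (Metric.closedBall_subset_ball (half_lt_self hδ) h)
      refine (contDiffAt_const (c := 0)).congr_of_eventuallyEq ?_
      filter_upwards [notMem_tsupport_iff_eventuallyEq.1 hxχ] with z hz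
      simp [hz]
  · filter_upwards [χ.eventuallyEq_one] with x hx
    simp [hx]

/-- The projection of `V` onto the kernel of the form `β` along the vector `v`; meaningful only
when `β v ≠ 0`. -/
noncomputable def projAlong (β : V →L[ℝ] ℝ) (v : V) : V →L[ℝ] V :=
  .id ℝ V - (β v)⁻¹ • β.smulRight v

theorem projAlong_apply (β : V →L[ℝ] ℝ) (v ξ : V) :
    projAlong β v ξ = ξ - ((β v)⁻¹ * β ξ) • v := by
  simp [projAlong, mul_smul]

theorem apply_projAlong {β : V →L[ℝ] ℝ} {v : V} (hv : β v ≠ 0) (ξ : V) :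
    β (projAlong β v ξ) = 0 := by
  rw [projAlong_apply, map_sub, map_smul, smul_eq_mul]
  field_simp
  ring

theorem projAlong_eq_self {β : V →L[ℝ] ℝ} {ξ : V} (hξ : β ξ = 0) (v : V) :
    projAlong β v ξ = ξ := by
  simp [projAlong_apply, hξ]

theorem projAlong_comp_projAlong {β : V →L[ℝ] ℝ} {v : V} (hv : β v ≠ 0) (β' : V →L[ℝ] ℝ) :
    projAlong β v ∘L projAlong β' v = projAlong β v := by
  ext ξ
  simp only [ContinuousLinearMap.comp_apply, projAlong_apply, map_sub, map_smul]
  match_scalars <;> field_simp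
  ring

theorem contDiffAt_projAlong {β : V → V →L[ℝ] ℝ} {v y : V} (hβ : ContDiffAt ℝ ∞ β y)
    (hv : β y v ≠ 0) : ContDiffAt ℝ ∞ (fun z => projAlong (β z) v) y := by
  have hβv : ContDiffAt ℝ ∞ (fun z => β z v) y := hβ.clm_apply contDiffAt_const
  exact contDiffAt_const.sub ((hβv.inv hv).smul (hβ.smulRight contDiffAt_const))

theorem fderiv_projAlong_comm {β : V → V →L[ℝ] ℝ} {v y : V} (hβ : ContDiffAt ℝ ∞ β y)
    (hv : β y v ≠ 0)
    (hinv : ∀ ξ η, β y (lieBracket ℝ (fun z => projAlong (β z) v ξ)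
      (fun z => projAlong (β z) v η) y) = 0) (ξ η : V) :
    fderiv ℝ (fun z => projAlong (β z) v) y (projAlong (β y) v ξ) η =
      fderiv ℝ (fun z => projAlong (β z) v) y (projAlong (β y) v η) ξ := by
  have hQ := ((contDiffAt_projAlong hβ hv).differentiableAt (by simp)).hasFDerivAt
  set D := fderiv ℝ (fun z => projAlong (β z) v) y
  have hQη (η : V) : HasFDerivAt (fun z => projAlong (β z) v η) (D.flip η) y := by
    simpa using hQ.clm_apply (hasFDerivAt_const η y)
  have hker (h η : V) : projAlong (β y) v (D h η) = 0 := by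
    have hconst : HasFDerivAt (fun _ : V => projAlong (β y) v η)
        (projAlong (β y) v ∘L D.flip η) y := by
      refine ((projAlong (β y) v).hasFDerivAt.comp y (hQη η)).congr_of_eventuallyEq
        (.of_forall fun z => ?_)
      exact congr($(projAlong_comp_projAlong hv (β z)) η).symm
    exact congr($(hconst.unique (hasFDerivAt_const _ y)) h)
  have hbracket : lieBracket ℝ (fun z => projAlong (β z) v ξ) (fun z => projAlong (β z) v η) y =
      D (projAlong (β y) v ξ) η - D (projAlong (β y) v η) ξ := by
    rw [lieBracket, (hQη ξ).fderiv, (hQη η).fderiv]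
    rfl
  rw [← sub_eq_zero, ← hbracket, ← projAlong_eq_self (hinv ξ η) v, hbracket, map_sub, hker, hker,
    sub_zero]

theorem exists_first_integral [CompleteSpace V] [HasContDiffBump V] {β : V → V →L[ℝ] ℝ}
    {v y₀ : V} (hβ : ∀ᶠ y in 𝓝 y₀, ContDiffAt ℝ ∞ β y) (hv : β y₀ v ≠ 0)
    (hinv : ∀ᶠ y in 𝓝 y₀, ∀ ξ η, β y (lieBracket ℝ (fun z => projAlong (β z) v ξ)
      (fun z => projAlong (β z) v η) y) = 0) :
    ∃ W : V → ℝ, ∀ᶠ y in 𝓝 y₀, ContDiffAt ℝ ∞ W y ∧ ∃ c : ℝ, c ≠ 0 ∧ fderiv ℝ W y = c • β y := by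
  have hv' : ∀ᶠ y in 𝓝 y₀, β y v ≠ 0 :=
    (hβ.self_of_nhds.continuousAt.clm_apply continuousAt_const).eventually_ne hv
  obtain ⟨Q, hQ, hQβ⟩ := exists_contDiff_eventuallyEq (f := fun y => projAlong (β y) v) (x₀ := y₀)
    (by filter_upwards [hβ, hv'] with y using contDiffAt_projAlong)
  have hproj : ∀ᶠ p in 𝓝 (y₀, y₀), Q p.1 ∘L Q p.2 = Q p.1 := by
    rw [nhds_prod_eq]
    filter_upwards [(hv'.and hQβ).prod_mk hQβ] with p ⟨⟨hp, hp₁⟩, hp₂⟩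
    rw [hp₁, hp₂, projAlong_comp_projAlong hp]
  have hcomm : ∀ᶠ y in 𝓝 y₀, ∀ ξ η, fderiv ℝ Q y (Q y ξ) η = fderiv ℝ Q y (Q y η) ξ := by
    filter_upwards [hβ, hv', hinv, hQβ.eventually_nhds] with y hy hyv hyinv hyQ
    rw [EventuallyEq.fderiv_eq hyQ, hyQ.self_of_nhds]
    exact fderiv_projAlong_comm hy hyv hyinv
  obtain ⟨ρ, hρ, hρ₀⟩ := exists_retraction_of_commute hQ hproj hcomm
  have hWρ {y : V} (hy : ContDiffAt ℝ ∞ ρ y) : fderiv ℝ (β y₀ ∘ ρ) y = β y₀ ∘L fderiv ℝ ρ y :=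
    ((β y₀).hasFDerivAt.comp y (hy.differentiableAt (by simp)).hasFDerivAt).fderiv
  have hW : ∀ᶠ y in 𝓝 y₀, ContDiffAt ℝ ∞ (β y₀ ∘ ρ) y :=
    hρ.mono fun y hy => (β y₀).contDiff.contDiffAt.comp y hy.1
  have hWv : ∀ᶠ y in 𝓝 y₀, fderiv ℝ (β y₀ ∘ ρ) y v ≠ 0 := by
    refine ContinuousAt.eventually_ne ((hW.self_of_nhds.fderiv_right
      (m := ∞) (by simp)).continuousAt.clm_apply continuousAt_const) ?_
    simp [hWρ hρ.self_of_nhds.1, hρ₀, hQβ.self_of_nhds, projAlong_apply, hv]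
  refine ⟨β y₀ ∘ ρ, ?_⟩
  filter_upwards [hρ, hW, hWv, hv', hQβ] with y ⟨hyρ, hρQ⟩ hyW hyWv hyv hyQ
  refine ⟨hyW, fderiv ℝ (β y₀ ∘ ρ) y v / β y v, div_ne_zero hyWv hyv, ?_⟩
  ext ξ
  have hξ : fderiv ℝ (β y₀ ∘ ρ) y (projAlong (β y) v ξ) = 0 := by
    rw [hWρ hyρ, ← hyQ]
    simpa using congr(β y₀ ($hρQ ξ))
  rw [projAlong_apply, map_sub, map_smul, sub_eq_zero, smul_eq_mul] at hξ
  rw [hξ, smul_apply, smul_eq_mul]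
  ring

end Frobenius

theorem mlieBracket_eq_lieBracket {V : Type*} [NormedAddCommGroup V] [NormedSpace ℝ V]
    (X Y : ∀ y : V, TangentSpace 𝓘(ℝ, V) y) :
    mlieBracket 𝓘(ℝ, V) X Y = lieBracket (E := V) ℝ X Y := by
  rw [← mlieBracketWithin_univ, mlieBracketWithin_eq_lieBracketWithin]
  exact lieBracketWithin_univ

theorem fderiv_lieBracket_eq_zero {V : Type*} [NormedAddCommGroup V] [NormedSpace ℝ V]
    {W : V → ℝ} {X Y : V → V} {y : V} (hW : ContDiffAt ℝ 2 W y)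
    (hX : DifferentiableAt ℝ X y) (hY : DifferentiableAt ℝ Y y)
    (hWX : ∀ᶠ z in 𝓝 y, fderiv ℝ W z (X z) = 0) (hWY : ∀ᶠ z in 𝓝 y, fderiv ℝ W z (Y z) = 0) :
    fderiv ℝ W y (lieBracket ℝ X Y y) = 0 := by
  rw [fderiv_apply_lieBracket hW (by simp) hY hX, EventuallyEq.fderiv_eq hWX,
    EventuallyEq.fderiv_eq hWY]
  simp

section Charts

variable {E : Type*} [NormedAddCommGroup E] [NormedSpace ℝ E] {H : Type*} [TopologicalSpace H]
  {I : ModelWithCorners ℝ E H} {N : Type*} [TopologicalSpace N] [ChartedSpace H N]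

/-- The expression in the chart at `x₀` of the differential 1-form `θ`. -/
noncomputable def chartForm (I : ModelWithCorners ℝ E H) (x₀ : N)
    (θ : ∀ x : N, TangentSpace I x →L[ℝ] ℝ) (y : E) : E →L[ℝ] ℝ :=
  θ ((extChartAt I x₀).symm y) ∘L (mfderiv% (extChartAt I x₀) ((extChartAt I x₀).symm y)).inverse

theorem chartForm_extChartAt {x₀ x : N} (hx : x ∈ (extChartAt I x₀).source)
    (θ : ∀ x : N, TangentSpace I x →L[ℝ] ℝ) :
    chartForm I x₀ θ (extChartAt I x₀ x) = θ x ∘L (mfderiv% (extChartAt I x₀) x).inverse := by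
  rw [chartForm, (extChartAt I x₀).left_inv hx]
  rfl

theorem apply_mpullback_extChartAt {x₀ x : N} (hx : x ∈ (extChartAt I x₀).source)
    (θ : ∀ x : N, TangentSpace I x →L[ℝ] ℝ) (X : E → E) :
    θ x (mpullback I 𝓘(ℝ, E) (extChartAt I x₀) X x) =
      chartForm I x₀ θ (extChartAt I x₀ x) (X (extChartAt I x₀ x)) := by
  rw [chartForm_extChartAt hx]
  rfl

theorem mfderiv_extChartAt_inverse_apply [IsManifold I 1 N] {x₀ x : N}
    (hx : x ∈ (extChartAt I x₀).source) (v : E) :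
    mfderiv% (extChartAt I x₀) x ((mfderiv% (extChartAt I x₀) x).inverse v) = v :=
  (((isInvertible_mfderiv_extChartAt hx).inverse_apply_eq).1 rfl).symm

theorem eventually_extChartAt_symm_mem [I.Boundaryless] {O : Set N} {x : N} (hO : O ∈ 𝓝 x) :
    ∀ᶠ y in 𝓝 (extChartAt I x x),
      y ∈ (extChartAt I x).target ∧ (extChartAt I x).symm y ∈ O := by
  refine .and (extChartAt_target_mem_nhds x) ((continuousAt_extChartAt_symm x).eventually ?_)
  rwa [extChartAt_to_inv]

theorem chartForm_comp_mfderiv [IsManifold I 1 N] {x₀ x : N} (hx : x ∈ (extChartAt I x₀).source)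
    (θ : ∀ x : N, TangentSpace I x →L[ℝ] ℝ) :
    chartForm I x₀ θ (extChartAt I x₀ x) ∘L mfderiv% (extChartAt I x₀) x = θ x := by
  rw [chartForm_extChartAt hx]
  ext v
  exact congrArg (θ x) (((isInvertible_mfderiv_extChartAt hx).inverse_apply_eq).2 rfl)

variable [IsManifold I ∞ N]

theorem mvfderiv_comp_extChartAt {W : E → ℝ} {x₀ x : N} (hx : x ∈ (extChartAt I x₀).source)
    (hW : DifferentiableAt ℝ W (extChartAt I x₀ x)) :
    mvfderiv I (W ∘ extChartAt I x₀) x =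
      fderiv ℝ W (extChartAt I x₀ x) ∘L mfderiv% (extChartAt I x₀) x := by
  rw [mvfderiv_comp x hW.mdifferentiableAt (mdifferentiableAt_extChartAt (by simpa using hx)),
    mvfderiv, mfderiv_eq_fderiv]
  rfl

/-- The differential 1-form `θ` is smooth on the set `O`. -/
abbrev IsSmoothFormOn (I : ModelWithCorners ℝ E H) [IsManifold I ∞ N]
    (θ : ∀ x : N, TangentSpace I x →L[ℝ] ℝ) (O : Set N) : Prop :=
  ContMDiffOn I (I.prod 𝓘(ℝ, E →L[ℝ] ℝ)) ∞
    (fun x => (⟨x, θ x⟩ : Bundle.TotalSpace (E →L[ℝ] ℝ)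
      (fun x : N => TangentSpace I x →L[ℝ] Bundle.Trivial N ℝ x))) O

/-- The kernel of the 1-form `θ` is closed under Lie brackets on `O`: the bracket of two smooth
vector fields on an open subset of `O` that are annihilated by `θ` is annihilated by `θ`. -/
def HasInvolutiveKernelOn (I : ModelWithCorners ℝ E H) [IsManifold I ∞ N]
    (θ : ∀ x : N, TangentSpace I x →L[ℝ] ℝ) (O : Set N) : Prop :=
  ∀ (U : Set N) (X Y : ∀ x : N, TangentSpace I x), IsOpen U → U ⊆ O →
    ContMDiffOn I I.tangent ∞ (T% X) U → ContMDiffOn I I.tangent ∞ (T% Y) U →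
    (∀ x ∈ U, θ x (X x) = 0) → (∀ x ∈ U, θ x (Y x) = 0) →
    ∀ x ∈ U, θ x (mlieBracket I X Y x) = 0

theorem isSmoothFormOn_iff_of_subset_source {θ : ∀ x : N, TangentSpace I x →L[ℝ] ℝ}
    {x₀ : N} {O : Set N} (hO : IsOpen O) (hO' : O ⊆ (extChartAt I x₀).source) :
    IsSmoothFormOn I θ O ↔
      ContMDiffOn I 𝓘(ℝ, E →L[ℝ] ℝ) ∞ (chartForm I x₀ θ ∘ extChartAt I x₀) O := by
  have : IsManifold I (∞ + 1) N := by simpa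
  have hchart : ∀ x ∈ O, x ∈ (chartAt H x₀).source := fun x hx => by simpa using hO' hx
  refine ((trivializationAt (E →L[ℝ] ℝ)
    (fun x : N => TangentSpace I x →L[ℝ] Bundle.Trivial N ℝ x) x₀).contMDiffOn_section_iff
      (IB := I) (n := ∞) (s := θ) hO fun x hx => by simpa using hchart x hx).trans
    (contMDiffOn_congr fun x hx => ?_)
  rw [hom_trivializationAt_apply, Function.comp_apply, chartForm_extChartAt (hO' hx)]
  change _ ∘L (θ x ∘L _) = _
  rw [TangentBundle.symmL_trivializationAt (hchart x hx),
    ← ContinuousLinearMap.inverse_eq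
      (mfderiv_extChartAt_comp_mfderivWithin_extChartAt_symm' (hO' hx))
      (mfderivWithin_extChartAt_symm_comp_mfderiv_extChartAt' (hO' hx))]
  ext v
  change (Bundle.Trivial.trivialization N ℝ).continuousLinearMapAt ℝ x _ = _
  rw [Bundle.Trivial.continuousLinearMapAt_trivialization]
  rfl

section VectorFields

variable [CompleteSpace E]

theorem contMDiffOn_mpullback_extChartAt {x₀ : N} {O : Set N}
    (hO : O ⊆ (extChartAt I x₀).source) {X : E → E}
    (hX : ∀ x ∈ O, ContDiffAt ℝ ∞ X (extChartAt I x₀ x)) :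
    ContMDiffOn I I.tangent ∞ (T% (mpullback I 𝓘(ℝ, E) (extChartAt I x₀) X)) O := by
  have : IsManifold I (∞ + 1) N := by simpa
  exact fun x hx => (ContMDiffAt.mpullback_vectorField_preimage (n := ∞)
    (contMDiffAt_vectorSpace_iff_contDiffAt.2 (hX x hx))
    (contMDiffAt_extChartAt' (by simpa using hO hx))
    (isInvertible_mfderiv_extChartAt (hO hx)) (by simp)).contMDiffWithinAt

theorem mlieBracket_mpullback_extChartAt {x₀ x : N} (hx : x ∈ (extChartAt I x₀).source)
    {X Y : E → E} (hX : ContDiffAt ℝ ∞ X (extChartAt I x₀ x))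
    (hY : ContDiffAt ℝ ∞ Y (extChartAt I x₀ x)) :
    mlieBracket I (mpullback I 𝓘(ℝ, E) (extChartAt I x₀) X)
        (mpullback I 𝓘(ℝ, E) (extChartAt I x₀) Y) x =
      (mfderiv% (extChartAt I x₀) x).inverse (lieBracket (E := E) ℝ X Y (extChartAt I x₀ x)) := by
  have : IsManifold I (minSmoothness ℝ 3) N :=
    .of_le (n := ∞) (by rw [minSmoothness_of_isRCLikeNormedField]; exact ENat.LEInfty.out)
  have hpull := mpullback_mlieBracket (I := I) (I' := 𝓘(ℝ, E)) (n := ∞) (f := extChartAt I x₀)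
    (V := X) (W := Y) (x₀ := x)
    ((contMDiffAt_vectorSpace_iff_contDiffAt.2 hX).mdifferentiableAt (by simp))
    ((contMDiffAt_vectorSpace_iff_contDiffAt.2 hY).mdifferentiableAt (by simp))
    (contMDiffAt_extChartAt' (by simpa using hx))
    (by rw [minSmoothness_of_isRCLikeNormedField]; exact ENat.LEInfty.out)
  refine hpull.symm.trans (congrArg (mfderiv% (extChartAt I x₀) x).inverse ?_)
  exact congrFun (mlieBracket_eq_lieBracket X Y) _

end VectorFields

variable [I.Boundaryless]

theorem contDiffAt_comp_extChartAt_symm {F : Type*} [NormedAddCommGroup F] [NormedSpace ℝ F]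
    {f : N → F} {x₀ x : N} (hx : x ∈ (extChartAt I x₀).source)
    (hf : ContMDiffAt I 𝓘(ℝ, F) ∞ f x) :
    ContDiffAt ℝ ∞ (f ∘ (extChartAt I x₀).symm) (extChartAt I x₀ x) := by
  rw [← contMDiffAt_iff_contDiffAt]
  refine ContMDiffAt.comp _ ?_ ((contMDiffOn_extChartAt_symm x₀).contMDiffAt
    ((isOpen_extChartAt_target x₀).mem_nhds ((extChartAt I x₀).map_source hx)))
  rwa [(extChartAt I x₀).left_inv hx]

theorem mvfderiv_eq_fderiv_comp_extChartAt_symm {W : N → ℝ} {x₀ x : N}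
    (hx : x ∈ (extChartAt I x₀).source) (hW : ContMDiffAt I 𝓘(ℝ, ℝ) ∞ W x) :
    mvfderiv I W x =
      fderiv ℝ (W ∘ (extChartAt I x₀).symm) (extChartAt I x₀ x) ∘L
        mfderiv% (extChartAt I x₀) x := by
  have hWe : W =ᶠ[𝓝 x] (W ∘ (extChartAt I x₀).symm) ∘ extChartAt I x₀ := by
    filter_upwards [extChartAt_source_mem_nhds' hx] with y hy
    exact congrArg W ((extChartAt I x₀).left_inv hy).symm
  have hmv : mvfderiv I W x = mvfderiv I ((W ∘ (extChartAt I x₀).symm) ∘ extChartAt I x₀) x :=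
    hWe.mfderiv_eq
  rw [hmv, mvfderiv_comp_extChartAt hx
    ((contDiffAt_comp_extChartAt_symm hx hW).differentiableAt (by simp))]

theorem contDiffAt_chartForm {θ : ∀ x : N, TangentSpace I x →L[ℝ] ℝ} {x₀ x : N} {O : Set N}
    (hO : IsOpen O) (hθ : IsSmoothFormOn I θ O) (hx : x ∈ O ∩ (extChartAt I x₀).source) :
    ContDiffAt ℝ ∞ (chartForm I x₀ θ) (extChartAt I x₀ x) := by
  have hO' := hO.inter (isOpen_extChartAt_source (I := I) x₀)
  have hβ := (isSmoothFormOn_iff_of_subset_source hO' inter_subset_right).1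
    (hθ.mono inter_subset_left)
  refine (contDiffAt_comp_extChartAt_symm hx.2
    (hβ.contMDiffAt (hO'.mem_nhds hx))).congr_of_eventuallyEq ?_
  filter_upwards [(isOpen_extChartAt_target x₀).mem_nhds ((extChartAt I x₀).map_source hx.2)]
    with y hy
  simp only [Function.comp_apply, (extChartAt I x₀).right_inv hy]

theorem isSmoothFormOn_mvfderiv {W : N → ℝ} {O : Set N} (hO : IsOpen O)
    (hW : ContMDiffOn I 𝓘(ℝ, ℝ) ∞ W O) :
    IsSmoothFormOn I (mvfderiv I W) O := by
  intro x₀ hx₀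
  have hO' := hO.inter (isOpen_extChartAt_source (I := I) x₀)
  suffices h : IsSmoothFormOn I (mvfderiv I W)
      (O ∩ (extChartAt I x₀).source) from
    (h.contMDiffAt (hO'.mem_nhds ⟨hx₀, mem_extChartAt_source x₀⟩)).contMDiffWithinAt
  refine (isSmoothFormOn_iff_of_subset_source hO' inter_subset_right).2 ?_
  have hWe {x : N} (hx : x ∈ O ∩ (extChartAt I x₀).source) :=
    contDiffAt_comp_extChartAt_symm hx.2 (hW.contMDiffAt (hO.mem_nhds hx.1))
  have hfderiv : ContMDiffOn I 𝓘(ℝ, E →L[ℝ] ℝ) ∞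
      (fderiv ℝ (W ∘ (extChartAt I x₀).symm) ∘ extChartAt I x₀) (O ∩ (extChartAt I x₀).source) :=
    fun x hx => (ContMDiffAt.comp x ((hWe hx).fderiv_right (m := ∞) (by simp)).contMDiffAt
      (contMDiffAt_extChartAt' (by simpa using hx.2))).contMDiffWithinAt
  refine hfderiv.congr fun x hx => ?_
  rw [Function.comp_apply, chartForm_extChartAt hx.2,
    mvfderiv_eq_fderiv_comp_extChartAt_symm hx.2 (hW.contMDiffAt (hO.mem_nhds hx.1))]
  ext v
  exact congrArg (fderiv ℝ (W ∘ (extChartAt I x₀).symm) (extChartAt I x₀ x))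
    (mfderiv_extChartAt_inverse_apply hx.2 v)

theorem eventually_fderiv_mpullbackWithin_extChartAt_symm {W : N → ℝ} {O : Set N} (hO : IsOpen O)
    (hW : ContMDiffOn I 𝓘(ℝ, ℝ) ∞ W O) {X : ∀ x : N, TangentSpace I x}
    (hX : ∀ x ∈ O, mvfderiv I W x (X x) = 0) {x : N} (hx : x ∈ O) :
    ∀ᶠ y in 𝓝 (extChartAt I x x), fderiv ℝ (W ∘ (extChartAt I x).symm) y
      (mpullbackWithin 𝓘(ℝ, E) I (extChartAt I x).symm X (range I) y) = 0 := by
  filter_upwards [eventually_extChartAt_symm_mem (I := I) (hO.mem_nhds hx)] with y ⟨hy, hyO⟩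
  have hWX := hX _ hyO
  rw [mvfderiv_eq_fderiv_comp_extChartAt_symm ((extChartAt I x).map_target hy)
    (hW.contMDiffAt (hO.mem_nhds hyO)), (extChartAt I x).right_inv hy] at hWX
  rw [mpullbackWithin_apply, ContinuousLinearMap.inverse_eq
    (mfderivWithin_extChartAt_symm_comp_mfderiv_extChartAt hy)
    (mfderiv_extChartAt_comp_mfderivWithin_extChartAt_symm hy)]
  exact hWX

variable [CompleteSpace E]

theorem contDiffAt_mpullbackWithin_extChartAt_symm {X : ∀ x : N, TangentSpace I x} {x : N}
    (hX : ContMDiffAt I I.tangent ∞ (T% X) x) :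
    ContDiffAt ℝ ∞ (mpullbackWithin 𝓘(ℝ, E) I (extChartAt I x).symm X (range I))
      (extChartAt I x x) := by
  have h := contMDiffWithinAt_mpullbackWithin_extChartAt_symm (n := ∞) hX.contMDiffWithinAt
    uniqueMDiffOn_univ (mem_univ x) (by simp)
  rw [preimage_univ, inter_univ] at h
  exact contMDiffAt_vectorSpace_iff_contDiffAt.1 (h.contMDiffAt (extChartAt_target_mem_nhds x))

theorem hasInvolutiveKernelOn_mvfderiv {W : N → ℝ} {O : Set N} (hO : IsOpen O)
    (hW : ContMDiffOn I 𝓘(ℝ, ℝ) ∞ W O) : HasInvolutiveKernelOn I (mvfderiv I W) O := by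
  intro U X Y hU hUO hX hY hWX hWY x hx
  have hWx : ContMDiffAt I 𝓘(ℝ, ℝ) ∞ W x := hW.contMDiffAt (hO.mem_nhds (hUO hx))
  have hX' := contDiffAt_mpullbackWithin_extChartAt_symm (hX.contMDiffAt (hU.mem_nhds hx))
  have hY' := contDiffAt_mpullbackWithin_extChartAt_symm (hY.contMDiffAt (hU.mem_nhds hx))
  have hpull (Z : ∀ x : N, TangentSpace I x) := nhdsWithin_univ x ▸
    eventuallyEq_mpullback_mpullbackWithin_extChartAt (I := I) (x := x) (s := univ) Z
  rw [(hpull X).mlieBracket_vectorField_eq (hpull Y),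
    mlieBracket_mpullback_extChartAt (mem_extChartAt_source x) hX' hY',
    mvfderiv_eq_fderiv_comp_extChartAt_symm (mem_extChartAt_source x) hWx]
  refine (congrArg (fderiv ℝ (W ∘ (extChartAt I x).symm) (extChartAt I x x))
    (mfderiv_extChartAt_inverse_apply (mem_extChartAt_source x) _)).trans ?_
  exact fderiv_lieBracket_eq_zero
    ((contDiffAt_comp_extChartAt_symm (mem_extChartAt_source x) hWx).of_le ENat.LEInfty.out)
    (hX'.differentiableAt (by simp)) (hY'.differentiableAt (by simp))
    (eventually_fderiv_mpullbackWithin_extChartAt_symm hU (hW.mono hUO) hWX hx)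
    (eventually_fderiv_mpullbackWithin_extChartAt_symm hU (hW.mono hUO) hWY hx)

theorem chartForm_lieBracket_projAlong_eq_zero {θ : ∀ x : N, TangentSpace I x →L[ℝ] ℝ}
    {O : Set N} (hO : IsOpen O) (hθ : IsSmoothFormOn I θ O) (hinv : HasInvolutiveKernelOn I θ O)
    {x₀ x : N} (hx : x ∈ O ∩ (extChartAt I x₀).source) {v : E}
    (hv : chartForm I x₀ θ (extChartAt I x₀ x) v ≠ 0) (ξ η : E) :
    chartForm I x₀ θ (extChartAt I x₀ x)
      (lieBracket ℝ (fun z => projAlong (chartForm I x₀ θ z) v ξ)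
        (fun z => projAlong (chartForm I x₀ θ z) v η) (extChartAt I x₀ x)) = 0 := by
  set β := chartForm I x₀ θ
  let X (ζ : E) : ∀ x : N, TangentSpace I x :=
    mpullback I 𝓘(ℝ, E) (extChartAt I x₀) fun z => projAlong (β z) v ζ
  let U := O ∩ (extChartAt I x₀).source ∩ {x | β (extChartAt I x₀ x) v ≠ 0}
  have hU : IsOpen U := by
    refine ContinuousOn.isOpen_inter_preimage (t := {0}ᶜ) (fun z hz => ?_)
      (hO.inter (isOpen_extChartAt_source x₀)) isOpen_compl_singleton
    exact (((contDiffAt_chartForm hO hθ hz).continuousAt.comp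
      (continuousAt_extChartAt' hz.2)).clm_apply continuousAt_const).continuousWithinAt
  have hsmooth (ζ : E) : ∀ z ∈ U,
      ContDiffAt ℝ ∞ (fun z => projAlong (β z) v ζ) (extChartAt I x₀ z) := fun z hz =>
    (contDiffAt_projAlong (contDiffAt_chartForm hO hθ hz.1) hz.2).clm_apply contDiffAt_const
  have hX (ζ : E) : ContMDiffOn I I.tangent ∞ (T% (X ζ)) U :=
    contMDiffOn_mpullback_extChartAt (fun z hz => hz.1.2) (hsmooth ζ)
  have hker (ζ : E) : ∀ z ∈ U, θ z (X ζ z) = 0 := fun z hz =>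
    (apply_mpullback_extChartAt hz.1.2 θ _).trans (apply_projAlong hz.2 ζ)
  have hbracket := hinv U (X ξ) (X η) hU (fun z hz => hz.1.1) (hX ξ) (hX η) (hker ξ) (hker η) x
    ⟨hx, hv⟩
  rw [mlieBracket_mpullback_extChartAt hx.2 (hsmooth ξ x ⟨hx, hv⟩) (hsmooth η x ⟨hx, hv⟩)]
    at hbracket
  exact (congr($(chartForm_extChartAt hx.2 θ) _)).trans hbracket

theorem exists_mvfderiv_eq_smul [HasContDiffBump E] {θ : ∀ x : N, TangentSpace I x →L[ℝ] ℝ}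
    {O : Set N} {x₀ : N} (hO : IsOpen O) (hx₀ : x₀ ∈ O) (hθ : IsSmoothFormOn I θ O)
    (h₀ : θ x₀ ≠ 0) (hinv : HasInvolutiveKernelOn I θ O) :
    ∃ (W : N → ℝ) (U : Set N), IsOpen U ∧ x₀ ∈ U ∧ ContMDiffOn I 𝓘(ℝ, ℝ) ∞ W U ∧
      ∀ x ∈ U, ∃ c : ℝ, c ≠ 0 ∧ mvfderiv I W x = c • θ x := by
  have hx₀s := mem_extChartAt_source (I := I) x₀
  set β := chartForm I x₀ θ with hβ
  have hβx₀ : β (extChartAt I x₀ x₀) ≠ 0 := fun h => h₀ <| by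
    rw [← chartForm_comp_mfderiv hx₀s θ, ← hβ, h]
    rfl
  obtain ⟨v, hv⟩ : ∃ v, β (extChartAt I x₀ x₀) v ≠ 0 := by
    by_contra! h
    exact hβx₀ (ContinuousLinearMap.ext h)
  have hβsmooth := contDiffAt_chartForm hO hθ ⟨hx₀, hx₀s⟩
  have hchart : ∀ᶠ y in 𝓝 (extChartAt I x₀ x₀),
      ∃ x ∈ O ∩ (extChartAt I x₀).source, extChartAt I x₀ x = y := by
    filter_upwards [eventually_extChartAt_symm_mem (I := I) (hO.mem_nhds hx₀)] with y ⟨hy, hyO⟩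
    exact ⟨_, ⟨hyO, (extChartAt I x₀).map_target hy⟩, (extChartAt I x₀).right_inv hy⟩
  obtain ⟨W, hW⟩ := exists_first_integral (β := β) (v := v) (y₀ := extChartAt I x₀ x₀)
    (by
      filter_upwards [hchart] with y ⟨x, hx, hxy⟩
      exact hxy ▸ contDiffAt_chartForm hO hθ hx)
    hv
    (by
      filter_upwards [hchart, (hβsmooth.continuousAt.clm_apply continuousAt_const).eventually_ne hv]
        with y ⟨x, hx, hxy⟩ hyv
      subst hxy
      exact chartForm_lieBracket_projAlong_eq_zero hO hθ hinv hx hyv)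
  obtain ⟨U, hUW, hU, hx₀U⟩ := eventually_nhds_iff.1
    (((continuousAt_extChartAt x₀).eventually hW).and (extChartAt_source_mem_nhds (I := I) x₀))
  refine ⟨W ∘ extChartAt I x₀, U, hU, hx₀U, fun x hx => ?_, fun x hx => ?_⟩
  · obtain ⟨⟨hWx, -⟩, hxs⟩ : _ ∧ x ∈ (extChartAt I x₀).source := hUW x hx
    exact (hWx.contMDiffAt.comp x
      (contMDiffAt_extChartAt' (by simpa using hxs))).contMDiffWithinAt
  · obtain ⟨⟨hWx, c, hc, hWc⟩, hxs⟩ := hUW x hx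
    refine ⟨c, hc, ?_⟩
    rw [mvfderiv_comp_extChartAt hxs (hWx.differentiableAt (by simp)), hWc,
      ← chartForm_comp_mfderiv hxs θ]
    rfl

end Charts

theorem exists_apply_eq_of_pos {V : Type*} [NormedAddCommGroup V] [NormedSpace ℝ V]
    [FiniteDimensional ℝ V] {B : V →L[ℝ] V →L[ℝ] ℝ} (hB : ∀ x, x ≠ 0 → 0 < B x x)
    (φ : V →L[ℝ] ℝ) : ∃ x, B x = φ := by
  have hinj : Function.Injective (B : V →ₗ[ℝ] V →L[ℝ] ℝ) := by
    refine (injective_iff_map_eq_zero _).2 fun x hx => ?_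
    by_contra hx0
    exact (hB x hx0).ne' congr($hx x)
  have hdim : Module.finrank ℝ V = Module.finrank ℝ (V →L[ℝ] ℝ) :=
    Subspace.dual_finrank_eq.symm.trans LinearMap.toContinuousLinearMap.finrank_eq
  exact (LinearMap.injective_iff_surjective_of_finrank_eq_finrank hdim).1 hinj φ

section Cylinder

variable {n : ℕ} {M : Type*} [TopologicalSpace M] [ChartedSpace (EuclideanSpace ℝ (Fin n)) M]

/-- The tangent vector `∂/∂v` of the cylinder. -/
def vert (n : ℕ) {M : Type*} [TopologicalSpace M] [ChartedSpace (EuclideanSpace ℝ (Fin n)) M]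
    (q : Cyl M) : TangentSpace (cylModel n) q :=
  ((0, 1) : EuclideanSpace ℝ (Fin n) × ℝ)

/-- The inclusion of the tangent space of `M` in the tangent space of the cylinder. -/
noncomputable def horiz (q : Cyl M) :
    TangentSpace (𝓡 n) q.1 →L[ℝ] TangentSpace (cylModel n) q :=
  ContinuousLinearMap.inl ℝ (EuclideanSpace ℝ (Fin n)) ℝ

theorem exists_eq_horiz_add_smul_vert (q : Cyl M) (w : TangentSpace (cylModel n) q) :
    ∃ (X : TangentSpace (𝓡 n) q.1) (t : ℝ), w = horiz q X + t • vert n q := by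
  have hsplit (w : EuclideanSpace ℝ (Fin n) × ℝ) : w = (w.1, 0) + w.2 • (0, 1) := by simp
  exact ⟨_, _, hsplit w⟩

theorem differential_horiz {W : Cyl M → ℝ} {q : Cyl M}
    (hW : MDifferentiableAt (cylModel n) 𝓘(ℝ, ℝ) W q) (X : TangentSpace (𝓡 n) q.1) :
    differential n W q (horiz q X) = gradM n W q X := by
  refine (mfderiv_prod_eq_add_apply (v := horiz q X) hW).trans ?_
  have hzero : mfderiv 𝓘(ℝ, ℝ) 𝓘(ℝ, ℝ) (fun s : PosReal => W (q.1, s)) q.2 (0 : ℝ) = 0 :=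
    map_zero _
  exact (congrArg (fun t : ℝ => gradM n W q X + t) hzero).trans (add_zero _)

theorem differential_vert {W : Cyl M → ℝ} {q : Cyl M}
    (hW : MDifferentiableAt (cylModel n) 𝓘(ℝ, ℝ) W q) :
    differential n W q (vert n q) = derivV W q := by
  refine (mfderiv_prod_eq_add_apply (v := vert n q) hW).trans ?_
  have hzero : gradM n W q (0 : EuclideanSpace ℝ (Fin n)) = 0 := map_zero _
  exact (congrArg (fun t : ℝ => t + derivV W q) hzero).trans (zero_add _)

theorem rulingTangent_eq_span_vert (q : Cyl M) : rulingTangent n q = ℝ ∙ vert n q := by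
  have hinr : mfderiv 𝓘(ℝ, ℝ) (cylModel n) (fun s : PosReal => ((q.1, s) : Cyl M)) q.2 =
    ContinuousLinearMap.inr ℝ (EuclideanSpace ℝ (Fin n)) ℝ := mfderiv_prod_right
  have hspan : LinearMap.range (LinearMap.inr ℝ (EuclideanSpace ℝ (Fin n)) ℝ) = ℝ ∙ (0, 1) := by
    ext w
    simp [Submodule.mem_span_singleton]
  rw [rulingTangent, hinr]
  exact hspan

theorem isCompl_ker_rulingTangent_iff {q : Cyl M} (φ : TangentSpace (cylModel n) q →L[ℝ] ℝ) :
    IsCompl (LinearMap.ker (φ : TangentSpace (cylModel n) q →ₗ[ℝ] ℝ)) (rulingTangent n q) ↔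
      φ (vert n q) ≠ 0 := by
  have : FiniteDimensional ℝ (TangentSpace (cylModel n) q) :=
    inferInstanceAs (FiniteDimensional ℝ (EuclideanSpace ℝ (Fin n) × ℝ))
  have hvert : vert n q ≠ 0 := fun h => one_ne_zero (congrArg Prod.snd h : (1 : ℝ) = 0)
  rw [rulingTangent_eq_span_vert]
  refine ⟨fun h hφ => hvert ?_, fun hφ => ?_⟩
  · exact Submodule.disjoint_def.1 h.disjoint _ hφ (Submodule.mem_span_singleton_self _)
  · refine Module.Dual.isCompl_ker_of_disjoint_of_ne_bot (fun h => hφ congr($h _)) ?_ (by simpa)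
    rw [Submodule.disjoint_span_singleton]
    exact fun h => absurd h hφ

/-- The covector on `M` whose negative has the kernel of `φ` as its graph; for `φ = dW` it is
`∇W / W_v`. Meaningful only when `φ` does not vanish on `∂/∂v`. -/
noncomputable def gradRatio {q : Cyl M} (φ : TangentSpace (cylModel n) q →L[ℝ] ℝ) :
    TangentSpace (𝓡 n) q.1 →L[ℝ] ℝ :=
  (φ (vert n q))⁻¹ • (φ ∘L horiz q)

theorem gradRatio_differential_apply {W : Cyl M → ℝ} {q : Cyl M}
    (hW : MDifferentiableAt (cylModel n) 𝓘(ℝ, ℝ) W q) (X : TangentSpace (𝓡 n) q.1) :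
    gradRatio (differential n W q) X = gradM n W q X / derivV W q := by
  rw [← differential_horiz hW, ← differential_vert hW, div_eq_inv_mul]
  rfl

theorem gradRatio_smul {q : Cyl M} (φ : TangentSpace (cylModel n) q →L[ℝ] ℝ) {c : ℝ}
    (hc : c ≠ 0) : gradRatio (c • φ) = gradRatio φ := by
  ext X
  change (c * φ (vert n q))⁻¹ * (c * φ (horiz q X)) = (φ (vert n q))⁻¹ * φ (horiz q X)
  field_simp

theorem eq_smul_of_gradRatio_eq {q : Cyl M} {φ ψ : TangentSpace (cylModel n) q →L[ℝ] ℝ}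
    (hφ : φ (vert n q) ≠ 0) (hψ : ψ (vert n q) ≠ 0) (h : gradRatio φ = gradRatio ψ) :
    φ = (φ (vert n q) / ψ (vert n q)) • ψ := by
  ext w
  obtain ⟨X, t, rfl⟩ := exists_eq_horiz_add_smul_vert q w
  have hX : (φ (vert n q))⁻¹ * φ (horiz q X) = (ψ (vert n q))⁻¹ * ψ (horiz q X) := congr($h X)
  rw [map_add, map_smul, smul_apply, map_add, map_smul]
  simp only [smul_eq_mul]
  field_simp at hX ⊢
  linarith

end Cylinder

section ProjSection

variable {n : ℕ} {M : Type*} [TopologicalSpace M] [ChartedSpace (EuclideanSpace ℝ (Fin n)) M]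
  {σ : ProjSection n M} {q : Cyl M} {φ : TangentSpace (cylModel n) q →L[ℝ] ℝ} {hφ : φ ≠ 0}

theorem exists_rep_eq_smul (h : σ q = Projectivization.mk ℝ φ hφ) :
    ∃ c : ℝ, c ≠ 0 ∧ (σ q).rep = c • φ := by
  rw [← (σ q).mk_rep] at h
  obtain ⟨c, hc⟩ := (Projectivization.mk_eq_mk_iff ℝ _ _ _ _).1 h
  exact ⟨c, c.ne_zero, hc.symm⟩

theorem kerSection_eq_ker (h : σ q = Projectivization.mk ℝ φ hφ) :
    kerSection σ q = LinearMap.ker (φ : TangentSpace (cylModel n) q →ₗ[ℝ] ℝ) := by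
  obtain ⟨c, hc, hrep⟩ := exists_rep_eq_smul h
  rw [kerSection, hrep]
  exact LinearMap.ker_smul _ c hc

theorem gradRatio_rep (h : σ q = Projectivization.mk ℝ φ hφ) :
    gradRatio (σ q).rep = gradRatio φ := by
  obtain ⟨c, hc, hrep⟩ := exists_rep_eq_smul h
  rw [hrep, gradRatio_smul φ hc]

theorem isCompl_kerSection_rulingTangent_iff (h : σ q = Projectivization.mk ℝ φ hφ) :
    IsCompl (kerSection σ q) (rulingTangent n q) ↔ φ (vert n q) ≠ 0 := by
  rw [kerSection_eq_ker h, isCompl_ker_rulingTangent_iff]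

variable [IsManifold (𝓡 n) ∞ M]

/-- The section `σ` is the class of `dW` on the open set `O`. -/
structure IsPotentialOn (σ : ProjSection n M) (W : Cyl M → ℝ) (O : Set (Cyl M)) : Prop where
  isOpen : IsOpen O
  contMDiffOn : ContMDiffOn (cylModel n) 𝓘(ℝ, ℝ) ∞ W O
  eq_mk : ∀ q ∈ O, ∃ hW : differential n W q ≠ 0,
    σ q = Projectivization.mk ℝ (differential n W q) hW

theorem isSmoothSection_of_isPotentialOn
    (hσ : ∀ q : Cyl M, ∃ (O : Set (Cyl M)) (W : Cyl M → ℝ), q ∈ O ∧ IsPotentialOn σ W O) :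
    IsSmoothSection σ := fun q =>
  let ⟨O, W, hq, hW⟩ := hσ q
  ⟨O, differential n W, hW.isOpen, hq, isSmoothFormOn_mvfderiv hW.isOpen hW.contMDiffOn, hW.eq_mk⟩

theorem isClosedSection_of_isPotentialOn
    (hσ : ∀ q : Cyl M, ∃ (O : Set (Cyl M)) (W : Cyl M → ℝ), q ∈ O ∧ IsPotentialOn σ W O) :
    IsClosedSection σ := by
  intro U X Y hU hX hY hXσ hYσ q hq
  obtain ⟨O, W, hqO, hW⟩ := hσ q
  have hker {r : Cyl M} (hr : r ∈ O) (w : TangentSpace (cylModel n) r) :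
      w ∈ kerSection σ r ↔ mvfderiv (cylModel n) W r w = 0 := by
    obtain ⟨_, hσr⟩ := hW.eq_mk r hr
    rw [kerSection_eq_ker hσr]
    rfl
  rw [hker hqO]
  exact hasInvolutiveKernelOn_mvfderiv hW.isOpen hW.contMDiffOn (U ∩ O) X Y
    (hU.inter hW.isOpen) inter_subset_right (hX.mono inter_subset_left) (hY.mono inter_subset_left)
    (fun r hr => (hker hr.2 _).1 (hXσ r hr.1)) (fun r hr => (hker hr.2 _).1 (hYσ r hr.1)) q
    ⟨hq, hqO⟩

theorem exists_isPotentialOn (hs : IsSmoothSection σ) (hc : IsClosedSection σ) (q₀ : Cyl M) :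
    ∃ (O : Set (Cyl M)) (W : Cyl M → ℝ), q₀ ∈ O ∧ IsPotentialOn σ W O := by
  obtain ⟨O, θ, hO, hq₀, hθs, hθ⟩ := hs q₀
  have hker {q : Cyl M} (hq : q ∈ O) (w : TangentSpace (cylModel n) q) :
      w ∈ kerSection σ q ↔ θ q w = 0 := by
    obtain ⟨_, hσq⟩ := hθ q hq
    rw [kerSection_eq_ker hσq]
    rfl
  have hinv : HasInvolutiveKernelOn (cylModel n) θ O := fun U X Y hU hUO hX hY hXθ hYθ q hq =>
    (hker (hUO hq) _).1 <| hc U X Y hU hX hY (fun r hr => (hker (hUO hr) _).2 (hXθ r hr))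
      (fun r hr => (hker (hUO hr) _).2 (hYθ r hr)) q hq
  obtain ⟨W, U, hU, hq₀U, hW, hWθ⟩ := exists_mvfderiv_eq_smul hO hq₀ hθs (hθ q₀ hq₀).1 hinv
  refine ⟨O ∩ U, W, ⟨hq₀, hq₀U⟩, hO.inter hU, hW.mono inter_subset_right, fun q hq => ?_⟩
  obtain ⟨hθq, hσq⟩ := hθ q hq.1
  obtain ⟨c, hc, hdW⟩ : ∃ c : ℝ, c ≠ 0 ∧ differential n W q = c • θ q := hWθ q hq.2
  refine ⟨hdW ▸ smul_ne_zero hc hθq, hσq.trans ?_⟩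
  exact ((Projectivization.mk_eq_mk_iff' ℝ _ _ _ _).2 ⟨c, hdW.symm⟩).symm

end ProjSection

section Force

variable {n : ℕ} {M : Type*} [TopologicalSpace M] [ChartedSpace (EuclideanSpace ℝ (Fin n)) M]
  [IsManifold (𝓡 n) ∞ M] {g : Metric n M} {p : M}

/-- The force covector `a N - v (2 b(N) N - b)` at the velocity `u = v N`; the force (1.4) is the
case `a = h(W) / W_v`, `b = ∇W / W_v`. -/
noncomputable def forceCovector (g : Metric n M) (p : M)
    (u : {u : TangentSpace (𝓡 n) p // u ≠ 0}) (a : ℝ) (b : TangentSpace (𝓡 n) p →L[ℝ] ℝ) :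
    TangentSpace (𝓡 n) p →L[ℝ] ℝ :=
  a • g.inner p (unitDir g p u) -
    (speed g p u : ℝ) • ((2 * b (unitDir g p u)) • g.inner p (unitDir g p u) - b)

theorem forceCovector_apply_self (u : {u : TangentSpace (𝓡 n) p // u ≠ 0}) (a : ℝ)
    (b : TangentSpace (𝓡 n) p →L[ℝ] ℝ) :
    forceCovector g p u a b u = speed g p u * (a - b u) := by
  have hv : (speed g p u : ℝ) ≠ 0 := (speed g p u).2.ne'
  have hsq : g.inner p u.1 u.1 = (speed g p u : ℝ) ^ 2 :=
    (Real.sq_sqrt (g.pos p u.1 u.2).le).symm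
  have hNu : g.inner p (unitDir g p u) u.1 = speed g p u := by
    rw [unitDir, map_smul]
    change (speed g p u : ℝ)⁻¹ * g.inner p u.1 u.1 = _
    rw [hsq]
    field_simp
  have hbN : b (unitDir g p u) = (speed g p u : ℝ)⁻¹ * b u.1 := by
    rw [unitDir, map_smul, smul_eq_mul]
  change a * g.inner p (unitDir g p u) u.1 - (speed g p u : ℝ) *
    (2 * b (unitDir g p u) * g.inner p (unitDir g p u) u.1 - b u.1) = _
  rw [hNu, hbN]
  field_simp
  ring

theorem speed_smul {X : TangentSpace (𝓡 n) p} {t : ℝ} (hX : X ≠ 0) (htX : t • X ≠ 0) :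
    (speed g p ⟨t • X, htX⟩ : ℝ) = |t| * speed g p ⟨X, hX⟩ := by
  change √(g.inner p (t • X) (t • X)) = |t| * √(g.inner p X X)
  have hinner : g.inner p (t • X) (t • X) = t ^ 2 * g.inner p X X := by
    rw [map_smul, map_smul, smul_apply]
    simp only [smul_eq_mul]
    ring
  rw [hinner, Real.sqrt_mul (sq_nonneg t), Real.sqrt_sq_eq_abs]

theorem exists_abs_eq_speed_smul (g : Metric n M) {X : TangentSpace (𝓡 n) p} (hX : X ≠ 0)
    (v : PosReal) :
    ∃ r : ℝ, 0 < r ∧ ∀ t : ℝ, |t| = r → ∃ htX : t • X ≠ 0, speed g p ⟨t • X, htX⟩ = v := by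
  have hpos : (0 : ℝ) < speed g p ⟨X, hX⟩ := (speed g p ⟨X, hX⟩).2
  have hr : (0 : ℝ) < v / speed g p ⟨X, hX⟩ := div_pos v.2 hpos
  refine ⟨v / speed g p ⟨X, hX⟩, hr, fun t ht => ?_⟩
  refine ⟨smul_ne_zero (abs_pos.1 (ht ▸ hr)) hX, Subtype.ext ?_⟩
  rw [speed_smul hX, ht, div_mul_cancel₀ _ hpos.ne']

theorem eq_of_forceCovector_eq {v : PosReal} {a a' : ℝ} {b b' : TangentSpace (𝓡 n) p →L[ℝ] ℝ}
    (h : ∀ u : {u : TangentSpace (𝓡 n) p // u ≠ 0}, speed g p u = v →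
      forceCovector g p u a b = forceCovector g p u a' b') : b = b' := by
  have hself {u : {u : TangentSpace (𝓡 n) p // u ≠ 0}} (hu : speed g p u = v) :
      a - b u = a' - b' u := by
    have hu' := congr($(h u hu) u)
    rw [forceCovector_apply_self, forceCovector_apply_self] at hu'
    exact mul_left_cancel₀ (speed g p u).2.ne' hu'
  ext X
  by_cases hX : X = 0
  · rw [hX, map_zero, map_zero]
  obtain ⟨r, hr, hrX⟩ := exists_abs_eq_speed_smul g hX v
  -- The values `a - b u` at opposite velocities separate the even part `a` from the odd part `b`.
  obtain ⟨_, hplus⟩ := hrX r (abs_of_pos hr)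
  obtain ⟨_, hminus⟩ := hrX (-r) (by rw [abs_neg, abs_of_pos hr])
  have hbplus := hself hplus
  have hbminus := hself hminus
  rw [map_smul, map_smul] at hbplus hbminus
  simp only [smul_eq_mul] at hbplus hbminus
  exact mul_left_cancel₀ hr.ne' (by linarith)

theorem forceCovector_gradRatio_differential_apply {W : Cyl M → ℝ}
    {u : {u : TangentSpace (𝓡 n) p // u ≠ 0}}
    (hW : MDifferentiableAt (cylModel n) 𝓘(ℝ, ℝ) W (p, speed g p u)) (a : ℝ)
    (X : TangentSpace (𝓡 n) p) :
    forceCovector g p u a (gradRatio (differential n W (p, speed g p u))) X =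
      a * g.inner p (unitDir g p u) X - (speed g p u : ℝ) *
        (2 * (gradM n W (p, speed g p u) (unitDir g p u) / derivV W (p, speed g p u))
            * g.inner p (unitDir g p u) X
          - gradM n W (p, speed g p u) X / derivV W (p, speed g p u)) := by
  rw [← gradRatio_differential_apply hW, ← gradRatio_differential_apply hW]
  rfl

end Force

section Correspondence

variable {n : ℕ} {M : Type*} [TopologicalSpace M] [ChartedSpace (EuclideanSpace ℝ (Fin n)) M]
  [IsManifold (𝓡 n) ∞ M] {g : Metric n M} {F : ForceField n M} {σ : ProjSection n M}

section Represents

variable {O : Set (Cyl M)} {h : ℝ → ℝ} {W : Cyl M → ℝ} {q : Cyl M}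

theorem Represents.mdifferentiableAt (H : Represents g F O h W) (hq : q ∈ O) :
    MDifferentiableAt (cylModel n) 𝓘(ℝ, ℝ) W q :=
  (H.smooth_W.contMDiffAt (H.isOpen.mem_nhds hq)).mdifferentiableAt (by simp)

theorem Represents.differential_vert_ne_zero (H : Represents g F O h W) (hq : q ∈ O) :
    differential n W q (vert n q) ≠ 0 := by
  rw [differential_vert (H.mdifferentiableAt hq)]
  exact H.derivV_ne_zero q hq

theorem Represents.differential_ne_zero (H : Represents g F O h W) (hq : q ∈ O) :
    differential n W q ≠ 0 := fun h0 =>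
  H.differential_vert_ne_zero hq congr($h0 _)

theorem Represents.inner_eq_forceCovector (H : Represents g F O h W) {p : M}
    {u : {u : TangentSpace (𝓡 n) p // u ≠ 0}} (hu : (p, speed g p u) ∈ O) :
    g.inner p (F p u) =
      forceCovector g p u (h (W (p, speed g p u)) / derivV W (p, speed g p u))
        (gradRatio (differential n W (p, speed g p u))) := by
  ext X
  rw [forceCovector_gradRatio_differential_apply (H.mdifferentiableAt hu), div_mul_eq_mul_div]
  exact H.formula p u hu X

theorem Represents.mk_eq_mk {O' : Set (Cyl M)} {h' : ℝ → ℝ} {W' : Cyl M → ℝ}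
    (H : Represents g F O h W) (H' : Represents g F O' h' W') (hq : q ∈ O) (hq' : q ∈ O') :
    Projectivization.mk ℝ (differential n W q) (H.differential_ne_zero hq) =
      Projectivization.mk ℝ (differential n W' q) (H'.differential_ne_zero hq') := by
  have hratio : gradRatio (differential n W q) = gradRatio (differential n W' q) := by
    obtain ⟨p, v⟩ := q
    refine eq_of_forceCovector_eq (g := g) (p := p) (v := v)
      (a := h (W (p, v)) / derivV W (p, v)) (a' := h' (W' (p, v)) / derivV W' (p, v))
      fun u hu => ?_
    subst hu
    exact (H.inner_eq_forceCovector hq).symm.trans (H'.inner_eq_forceCovector hq')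
  exact (Projectivization.mk_eq_mk_iff' ℝ _ _ _ _).2 ⟨_, (eq_smul_of_gradRatio_eq
    (H.differential_vert_ne_zero hq) (H'.differential_vert_ne_zero hq') hratio).symm⟩

end Represents

theorem exists_determines (hF : HasNormalShiftForm g F) : ∃ σ, Determines g F σ := by
  choose O h W hO H using hF
  exact ⟨fun q => Projectivization.mk ℝ (differential n (W q) q)
      ((H q).differential_ne_zero (hO q)),
    fun O' h' W' H' q hq => ⟨H'.differential_ne_zero hq, (H q).mk_eq_mk H' (hO q) hq⟩⟩

theorem Determines.eq {σ' : ProjSection n M} (hσ : Determines g F σ) (hσ' : Determines g F σ')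
    (hF : HasNormalShiftForm g F) : σ = σ' := by
  funext q
  obtain ⟨O, h, W, hq, H⟩ := hF q
  exact (hσ O h W H q hq).2.trans (hσ' O h W H q hq).2.symm

theorem Determines.exists_isPotentialOn (hσ : Determines g F σ) (hF : HasNormalShiftForm g F)
    (q : Cyl M) : ∃ (O : Set (Cyl M)) (W : Cyl M → ℝ), q ∈ O ∧ IsPotentialOn σ W O :=
  let ⟨O, h, W, hq, H⟩ := hF q
  ⟨O, W, hq, H.isOpen, H.smooth_W, hσ O h W H⟩

theorem Determines.isTransversal (hσ : Determines g F σ) (hF : HasNormalShiftForm g F) :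
    IsTransversal σ := by
  intro q
  obtain ⟨O, h, W, hq, H⟩ := hF q
  exact (isCompl_kerSection_rulingTangent_iff (hσ O h W H q hq).2).2
    (H.differential_vert_ne_zero hq)

theorem IsPotentialOn.represents {W : Cyl M → ℝ} {O : Set (Cyl M)} (hW : IsPotentialOn σ W O)
    (ht : IsTransversal σ)
    (hF : ∀ p u, g.inner p (F p u) =
      forceCovector g p u 0 (gradRatio (σ (p, speed g p u)).rep)) :
    Represents g F O 0 W := by
  have hdiff {q : Cyl M} (hq : q ∈ O) : MDifferentiableAt (cylModel n) 𝓘(ℝ, ℝ) W q :=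
    (hW.contMDiffOn.contMDiffAt (hW.isOpen.mem_nhds hq)).mdifferentiableAt (by simp)
  refine ⟨hW.isOpen, hW.contMDiffOn, contDiffOn_const, fun q hq => ?_, fun p u hu X => ?_⟩
  · obtain ⟨_, hσq⟩ := hW.eq_mk q hq
    rw [← differential_vert (hdiff hq)]
    exact (isCompl_kerSection_rulingTangent_iff hσq).1 (ht q)
  · obtain ⟨_, hσq⟩ := hW.eq_mk _ hu
    rw [hF, gradRatio_rep hσq, forceCovector_gradRatio_differential_apply (hdiff hu),
      Pi.zero_apply, zero_mul, zero_div]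

theorem exists_forceField (g : Metric n M) (hs : IsSmoothSection σ) (hc : IsClosedSection σ)
    (ht : IsTransversal σ) : ∃ F, HasNormalShiftForm g F ∧ Determines g F σ := by
  choose F hF using fun (p : M) (u : {u : TangentSpace (𝓡 n) p // u ≠ 0}) =>
    exists_apply_eq_of_pos (V := EuclideanSpace ℝ (Fin n)) (g.pos p)
      (forceCovector g p u 0 (gradRatio (σ (p, speed g p u)).rep))
  choose O W hqO hW using exists_isPotentialOn hs hc
  have H (q : Cyl M) : Represents g F (O q) 0 (W q) := (hW q).represents ht hF
  refine ⟨F, fun q => ⟨O q, 0, W q, hqO q, H q⟩, fun O' h' W' H' q hq => ?_⟩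
  obtain ⟨_, hσq⟩ := (hW q).eq_mk q (hqO q)
  exact ⟨H'.differential_ne_zero hq, hσq.trans ((H q).mk_eq_mk H' (hqO q) hq)⟩

end Correspondence

end NormalShift

theorem theorem5p1 (n : ℕ) {M : Type*} [TopologicalSpace M]
    [ChartedSpace (EuclideanSpace ℝ (Fin n)) M] [IsManifold (𝓡 n) ∞ M]
    (g : NormalShift.Metric n M) :
    (∀ F : NormalShift.ForceField n M, NormalShift.HasNormalShiftForm g F →
      ∃ σ : NormalShift.ProjSection n M,
        NormalShift.Determines g F σ ∧
        (∀ σ' : NormalShift.ProjSection n M, NormalShift.Determines g F σ' → σ' = σ) ∧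
        NormalShift.IsSmoothSection σ ∧
        NormalShift.IsClosedSection σ ∧
        NormalShift.IsTransversal σ) ∧
    (∀ σ : NormalShift.ProjSection n M,
      NormalShift.IsSmoothSection σ →
      NormalShift.IsClosedSection σ →
      NormalShift.IsTransversal σ →
      ∃ F : NormalShift.ForceField n M,
        NormalShift.HasNormalShiftForm g F ∧ NormalShift.Determines g F σ) := by
  refine ⟨fun F hF => ?_, fun σ hs hc ht => NormalShift.exists_forceField g hs hc ht⟩
  obtain ⟨σ, hσ⟩ := NormalShift.exists_determines hF
  have hpot := hσ.exists_isPotentialOn hF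
  exact ⟨σ, hσ, fun σ' hσ' => hσ'.eq hσ hF, NormalShift.isSmoothSection_of_isPotentialOn hpot,
    NormalShift.isClosedSection_of_isPotentialOn hpot, hσ.isTransversal hF⟩
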